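/- Notation. Let $k$ be a field and $A$ a finite dimensional $k$-algebra; $\mathrm{mod}\,A$ is the category of finite dimensional left $A$-modules. For $U\in\mathrm{mod}\,A$ the projection functor $p_U:\mathrm{mod}\,A\to\mathrm{mod}\,A$ sends $M$ to its quotient by the greatest submodule of $M$ that is a quotient of some $U^{\oplus d}$, and a homomorphism to the induced one. $\mathcal M(A)$ is the monoid, under composition $[F][G]=[F\circ G]$, generated by the natural isomorphism classes of the functors $p_S$, $S$ a simple $A$-module. Let $n\in\mathbb N$, let $Q_n$ be the quiver $1\to2\to\cdots\to n$, with path algebra $kQ_n$ (paths composed from right to left), simple module $S_t$ at the vertex $t$, $p_t=[p_{S_t}]$ and $\mathcal M(Q_n)=\mathcal M(kQ_n)$. For a field $R$ (for instance $R=k$) let $A_n=R\,\mathcal M(Q_n)$ be the monoid algebra. $P_n$ is the poset of all subsets of $[n]=\{1,\dots,n\}$ in which $K=\{k_1<\dots<k_r\}\ge J=\{j_1<\dots<j_m\}$ if and only if $r=m$ and $k_i\ge j_i$ for all $i$. Its incidence algebra $\mathrm{Inc}(P_n)$ over $R$ has the $R$-basis $X_{(K,J)}$ ($K\ge J$) and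 the product $X_{(K,J)}X_{(J',I)}=X_{(K,I)}$ if $J=J'$, and $0$ otherwise. Define elements of $A_n$ as follows, for $1\le m\le n$. Put $y_k^m=0$ for $k>m\geq 0$, and $$y_1^m=y_1^{m-1}-p_my_1^{m-1}+p_m,\qquad y_k^m=y_k^{m-1}-p_my_k^{m-1}+y_{k-1}^{m-1}p_m\quad(2\le k\le m).$$ Put $z_0=1-y_1^n$ and $z_k=y_k^n-y_{k+1}^n$ for $1\le k\le n$. For $\emptyset\ne J\subseteq[m]$ put $$g_J^m=g_J^{m-1}-p_mg_J^{m-1}\ (m\notin J),\qquad g_{\{m\}}^m=p_m,\qquad g_J^m=g_{J\setminus\{m\}}^{m-1}p_m\ (m\in J\ne\{m\}).$$ Put $f_\emptyset=z_0$ and $f_J=g_J^n z_{|J|}$ for $\emptyset\neq J\subseteq[n]$. For $K\ge J$ as above, let $$p_{(K,J)}=(p_{k_1}p_{k_1-1}\cdots p_{j_1})(p_{k_2}p_{k_2-1}\cdots p_{j_2})\cdots(p_{k_r}p_{k_r-1}\cdots p_{j_r}),\qquad p_{(\emptyset,\emptyset)}=1.$$ Theorem. For all $n\in\mathbb N$ and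 all fields $k$ and $R$, the unique $R$-linear map $\Phi:\mathrm{Inc}(P_n)\to A_n$ with $$\Phi(X_{(K,J)})=f_K\,p_{(K,J)}\,f_J\qquad\text{for all }K\ge J$$ is an isomorphism of $R$-algebras. The construction does not depend on the characteristic: there are noncommutative polynomials $c_{K,J}\in\mathbb Z\langle x_1,\dots,x_n\rangle$, depending only on $n$, $K$ and $J$, such that $\Phi(X_{(K,J)})=c_{K,J}(p_1,\dots,p_n)$ for all $K\ge J$ and all fields $k$ and $R$. -/

import Mathlib

open CategoryTheory

universe u v

noncomputable section

/-! ## Projection functors on the category of finite dimensional modules -/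

section ProjectionFunctors

variable (k : Type u) [Field k] (A : Type u) [Ring A] [Algebra k A]

/-- The property of an `A`-module of being finite dimensional over the field `k`. -/
def isFinDim : ObjectProperty (ModuleCat.{u} A) :=
  fun M => FiniteDimensional k ((ModuleCat.restrictScalars (algebraMap k A)).obj M)

/-- `mod A`: the category of finite dimensional left `A`-modules. -/
abbrev FinDimMod : Type (u + 1) := (isFinDim k A).FullSubcategory

/-- `X` lies in `gen U`: it is isomorphic to a quotient of some finite power of `U`. -/
def IsGeneratedBy (U X : Type u) [AddCommGroup U] [Module A U] [AddCommGroup X] [Module A X] :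
    Prop :=
  ∃ (d : ℕ) (f : (Fin d → U) →ₗ[A] X), Function.Surjective f

/-- The sum of all submodules of `M` that lie in `gen U`.  For a finite dimensional `M` it is
the greatest submodule in `gen U`, see `isGreatest_genSubmodule`. -/
def genSubmodule (U M : Type u) [AddCommGroup U] [Module A U] [AddCommGroup M] [Module A M] :
    Submodule A M :=
  sSup {X : Submodule A M | IsGeneratedBy A U X}

variable {A}

theorem IsGeneratedBy.sup {U M : Type u} [AddCommGroup U] [Module A U] [AddCommGroup M]
    [Module A M] {X Y : Submodule A M} (hX : IsGeneratedBy A U X) (hY : IsGeneratedBy A U Y) :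
    IsGeneratedBy A U (X ⊔ Y : Submodule A M) := by
  obtain ⟨d, f, hf⟩ := hX
  obtain ⟨e, g, hg⟩ := hY
  refine ⟨d + e,
    ((Submodule.inclusion le_sup_left).comp f).comp (LinearMap.funLeft A U (Fin.castAdd e)) +
    ((Submodule.inclusion le_sup_right).comp g).comp (LinearMap.funLeft A U (Fin.natAdd d)), ?_⟩
  rintro ⟨m, hm⟩
  obtain ⟨x, hx, y, hy, rfl⟩ := Submodule.mem_sup.1 hm
  obtain ⟨a, ha⟩ := hf ⟨x, hx⟩
  obtain ⟨b, hb⟩ := hg ⟨y, hy⟩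
  refine ⟨Fin.append a b, ?_⟩
  have h1 : LinearMap.funLeft A U (Fin.castAdd e) (Fin.append a b) = a := by
    ext i; simp [LinearMap.funLeft_apply]
  have h2 : LinearMap.funLeft A U (Fin.natAdd d) (Fin.append a b) = b := by
    ext i; simp [LinearMap.funLeft_apply]
  apply Subtype.ext
  simp [h1, h2, ha, hb]

theorem IsGeneratedBy.bot {U M : Type u} [AddCommGroup U] [Module A U] [AddCommGroup M]
    [Module A M] : IsGeneratedBy A U (⊥ : Submodule A M) :=
  ⟨0, 0, fun _ => ⟨0, Subsingleton.elim _ _⟩⟩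

theorem isNoetherian_of_isFinDim (M : ModuleCat.{u} A) (hM : isFinDim k A M) :
    IsNoetherian A M := by
  let M' := (ModuleCat.restrictScalars (algebraMap k A)).obj M
  have : FiniteDimensional k M' := hM
  have hk : IsNoetherian k M' := inferInstance
  rw [isNoetherian_iff] at hk ⊢
  let r : Submodule A M → Submodule k M' := fun X =>
    { carrier := (X : Set M)
      add_mem' := fun ha hb => X.add_mem ha hb
      zero_mem' := X.zero_mem
      smul_mem' := fun c _ hx => X.smul_mem (algebraMap k A c) hx }
  exact Subrelation.wf (r := InvImage (· > ·) r) (fun h => h) (InvImage.wf r hk)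

theorem isGreatest_genSubmodule (U : Type u) [AddCommGroup U] [Module A U]
    (M : ModuleCat.{u} A) (hM : isFinDim k A M) :
    IsGreatest {X : Submodule A M | IsGeneratedBy A U X} (genSubmodule A U M) := by
  have := isNoetherian_of_isFinDim k M hM
  refine ⟨?_, fun X hX => le_sSup hX⟩
  have hc : CompleteLattice.IsSupClosedCompact (Submodule A M) :=
    (CompleteLattice.isSupClosedCompact_iff_wellFoundedGT (Submodule A M)).2 inferInstance
  exact hc _ ⟨⊥, IsGeneratedBy.bot⟩ fun X hX Y hY => IsGeneratedBy.sup hX hY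

theorem genSubmodule_le_comap {U M N : Type u} [AddCommGroup U] [Module A U] [AddCommGroup M]
    [Module A M] [AddCommGroup N] [Module A N] (φ : M →ₗ[A] N) :
    genSubmodule A U M ≤ (genSubmodule A U N).comap φ := by
  refine sSup_le fun X hX => ?_
  rw [← Submodule.map_le_iff_le_comap]
  refine le_sSup ?_
  obtain ⟨d, f, hf⟩ := hX
  refine ⟨d, (φ.submoduleMap X).comp f, ?_⟩
  exact (φ.submoduleMap_surjective X).comp hf

theorem isFinDim_quotient (M : ModuleCat.{u} A) (hM : isFinDim k A M) (X : Submodule A M) :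
    isFinDim k A (ModuleCat.of A (M ⧸ X)) := by
  let M' := (ModuleCat.restrictScalars (algebraMap k A)).obj M
  let N' := (ModuleCat.restrictScalars (algebraMap k A)).obj (ModuleCat.of A (M ⧸ X))
  have : FiniteDimensional k M' := hM
  let g : M' →ₗ[k] N' :=
    { toFun := X.mkQ
      map_add' := fun a b => X.mkQ.map_add a b
      map_smul' := fun c a => X.mkQ.map_smul (algebraMap k A c) a }
  exact Module.Finite.of_surjective g X.mkQ_surjective

variable (A)

/-- The projection functor `p_U` of `mod A`, sending `M` to its quotient by the greatest
submodule in `gen U`, and a homomorphism to the induced one. -/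
def projFunctor (U : FinDimMod k A) : FinDimMod k A ⥤ FinDimMod k A where
  obj M := ⟨ModuleCat.of A (M.obj ⧸ genSubmodule A U.obj M.obj),
    isFinDim_quotient k M.obj M.property _⟩
  map {M N} φ := ObjectProperty.homMk (ModuleCat.ofHom
    (Submodule.mapQ (genSubmodule A U.obj M.obj) (genSubmodule A U.obj N.obj) φ.hom.hom
      (genSubmodule_le_comap φ.hom.hom)))
  map_id _ := ObjectProperty.hom_ext _ (ModuleCat.hom_ext (Submodule.mapQ_id _))
  map_comp φ ψ := ObjectProperty.hom_ext _ (ModuleCat.hom_ext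
    (Submodule.mapQ_comp _ _ _ φ.hom.hom ψ.hom.hom
      (genSubmodule_le_comap _) (genSubmodule_le_comap _)))

end ProjectionFunctors

/-- Natural isomorphism classes of endofunctors of a category. -/
def EndoClass (C : Type*) [Category C] := Quotient (isIsomorphicSetoid (C ⥤ C))

/-- The class of an endofunctor. -/
def EndoClass.mk {C : Type*} [Category C] (F : C ⥤ C) : EndoClass C :=
  Quotient.mk (isIsomorphicSetoid (C ⥤ C)) F

/-- The monoid structure on classes of endofunctors: `[F] * [G] = [F ∘ G]`, where `F ∘ G`
applies `G` first. -/
instance EndoClass.instMonoid (C : Type*) [Category C] : Monoid (EndoClass C) where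
  mul := Quotient.map₂ (fun F G => G ⋙ F)
    (fun _ _ ⟨α⟩ _ _ ⟨β⟩ => ⟨Functor.isoWhiskerRight β _ ≪≫ Functor.isoWhiskerLeft _ α⟩)
  one := EndoClass.mk (𝟭 C)
  mul_assoc a b c := by
    induction a using Quotient.inductionOn
    induction b using Quotient.inductionOn
    induction c using Quotient.inductionOn
    exact Quotient.sound ⟨(Functor.associator _ _ _).symm⟩
  one_mul a := by
    induction a using Quotient.inductionOn
    exact Quotient.sound ⟨Functor.rightUnitor _⟩
  mul_one a := by
    induction a using Quotient.inductionOn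
    exact Quotient.sound ⟨Functor.leftUnitor _⟩

/-- The monoid `M(A)` generated by the classes of the projection functors `p_S` attached to the
simple `A`-modules `S`. -/
def projMonoid (k : Type u) [Field k] (A : Type u) [Ring A] [Algebra k A] :
    Submonoid (EndoClass (FinDimMod k A)) :=
  Submonoid.closure {c | ∃ S : FinDimMod k A, IsSimpleModule A S.obj ∧
    c = EndoClass.mk (projFunctor k A S)}


/-! ## Path algebras of finite quivers -/

section PathAlgebra

open Quiver

/-- The underlying space of the path algebra of a quiver over `k`: the free `k`-module on all
paths, including the trivial path at each vertex. -/
def PathAlgebra (k : Type u) [Field k] (V : Type) [Quiver.{0} V] : Type u :=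
  (Σ a b : V, Path a b) →₀ k

namespace PathAlgebra

variable {k : Type u} [Field k] {V : Type} [Quiver.{0} V]

instance : AddCommGroup (PathAlgebra k V) :=
  inferInstanceAs (AddCommGroup ((Σ a b : V, Path a b) →₀ k))

instance : Module k (PathAlgebra k V) :=
  inferInstanceAs (Module k ((Σ a b : V, Path a b) →₀ k))

/-- The scalar multiple `r • p` of a path `p`. -/
def single {a b : V} (p : Path a b) (r : k) : PathAlgebra k V :=
  Finsupp.single (⟨a, b, p⟩ : Σ a b : V, Path a b) r

open scoped Classical in
/-- The product `q p` of two paths: first `p`, then `q`, if `p` ends where `q` starts, and `0`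
otherwise. -/
def pathMul (q p : Σ a b : V, Path a b) : PathAlgebra k V :=
  if h : p.2.1 = q.1 then single (p.2.2.comp (q.2.2.cast h.symm rfl)) 1 else 0

/-- The linear extension of a function on paths. -/
def liftPath {W : Type*} [AddCommGroup W] [Module k W] (φ : (Σ a b : V, Path a b) → W) :
    PathAlgebra k V →ₗ[k] W :=
  Finsupp.lift W k (Σ a b : V, Path a b) φ

theorem liftPath_single {W : Type*} [AddCommGroup W] [Module k W]
    (φ : (Σ a b : V, Path a b) → W) {a b : V} (p : Path a b) (r : k) :
    liftPath φ (single p r) = r • φ ⟨a, b, p⟩ :=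
  Finsupp.sum_single_index (zero_smul k _)

/-- The bilinear extension of the product of paths. -/
def mulBilin : PathAlgebra k V →ₗ[k] PathAlgebra k V →ₗ[k] PathAlgebra k V :=
  liftPath fun q => liftPath fun p => pathMul q p

instance : Mul (PathAlgebra k V) := ⟨fun f g => mulBilin f g⟩

/-- The unit is the sum of all trivial paths. -/
instance [Fintype V] : One (PathAlgebra k V) := ⟨∑ a : V, single (Path.nil : Path a a) 1⟩

theorem mul_def (f g : PathAlgebra k V) : f * g = mulBilin f g := rfl

theorem one_def [Fintype V] :
    (1 : PathAlgebra k V) = ∑ a : V, single (Path.nil : Path a a) 1 := rfl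

theorem single_mul_single_eq {a b c d : V} (q : Path c d) (p : Path a b) (r s : k) :
    single q r * single p s = (r * s) • pathMul ⟨c, d, q⟩ ⟨a, b, p⟩ := by
  rw [mul_def, mulBilin, liftPath_single, LinearMap.smul_apply, liftPath_single, smul_smul]

theorem single_mul_single {a b c : V} (q : Path b c) (p : Path a b) (r s : k) :
    single q r * single p s = single (p.comp q) (r * s) := by
  rw [single_mul_single_eq, pathMul, dif_pos rfl]
  exact (Finsupp.smul_single _ _ _).trans (by rw [smul_eq_mul, mul_one]; rfl)

theorem single_mul_single_of_ne {a b c d : V} (q : Path c d) (p : Path a b) (r s : k)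
    (h : b ≠ c) : single q r * single p s = 0 := by
  rw [single_mul_single_eq, pathMul, dif_neg h, smul_zero]

@[elab_as_elim]
theorem induction {P : PathAlgebra k V → Prop} (f : PathAlgebra k V) (zero : P 0)
    (add : ∀ f g, P f → P g → P (f + g))
    (single : ∀ {a b : V} (p : Path a b) (r : k), P (single p r)) : P f :=
  Finsupp.induction_linear f zero add fun x r => single x.2.2 r

instance instNonUnitalRing : NonUnitalRing (PathAlgebra k V) :=
  { (inferInstance : AddCommGroup (PathAlgebra k V)),
    (inferInstance : Mul (PathAlgebra k V)) with
    left_distrib := fun f g h => by simp [mul_def]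
    right_distrib := fun f g h => by simp [mul_def]
    zero_mul := fun f => by simp [mul_def]
    mul_zero := fun f => by simp [mul_def]
    mul_assoc := fun f g h => by
      have hl : ∀ x y z : PathAlgebra k V, (x + y) * z = x * z + y * z := by simp [mul_def]
      have hr : ∀ x y z : PathAlgebra k V, x * (y + z) = x * y + x * z := by simp [mul_def]
      have h0 : ∀ x : PathAlgebra k V, 0 * x = 0 := by simp [mul_def]
      have h0' : ∀ x : PathAlgebra k V, x * 0 = 0 := by simp [mul_def]
      induction f using PathAlgebra.induction with
      | zero => simp only [h0]
      | add f f' hf hf' => simp only [hl, hf, hf']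
      | single p r =>
        induction g using PathAlgebra.induction with
        | zero => simp only [h0, h0']
        | add g g' hg hg' => simp only [hl, hr, hg, hg']
        | single q s =>
          induction h using PathAlgebra.induction with
          | zero => simp only [h0']
          | add h h' hh hh' => simp only [hr, hh, hh']
          | @single a b x t =>
            rename_i c d e f
            by_cases h1 : f = c
            · subst h1
              by_cases h2 : b = e
              · subst h2
                simp only [single_mul_single, Path.comp_assoc, mul_assoc]
              · rw [single_mul_single, single_mul_single_of_ne _ _ _ _ h2,
                  single_mul_single_of_ne _ _ _ _ h2, h0']
            · rw [single_mul_single_of_ne _ _ _ _ h1, h0]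
              by_cases h2 : b = e
              · subst h2
                rw [single_mul_single, single_mul_single_of_ne _ _ _ _ h1]
              · rw [single_mul_single_of_ne _ _ _ _ h2, h0'] }

variable [Fintype V]

instance instRing : Ring (PathAlgebra k V) :=
  { instNonUnitalRing, (inferInstance : One (PathAlgebra k V)) with
    one_mul := fun f => by
      induction f using PathAlgebra.induction with
      | zero => exact mul_zero _
      | add f g hf hg => exact (mul_add _ f g).trans (by rw [hf, hg])
      | @single a b p r =>
        change (1 : PathAlgebra k V) * _ = _
        rw [one_def, Finset.sum_mul, Finset.sum_eq_single b]
        · rw [single_mul_single, Path.comp_nil, one_mul]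
        · intro c _ hc
          exact single_mul_single_of_ne _ _ _ _ hc.symm
        · simp
    mul_one := fun f => by
      induction f using PathAlgebra.induction with
      | zero => exact zero_mul _
      | add f g hf hg => exact (add_mul f g _).trans (by rw [hf, hg])
      | @single a b p r =>
        change _ * (1 : PathAlgebra k V) = _
        rw [one_def, Finset.mul_sum, Finset.sum_eq_single a]
        · rw [single_mul_single, Path.nil_comp, mul_one]
        · intro c _ hc
          exact single_mul_single_of_ne _ _ _ _ hc
        · simp }

instance : Algebra k (PathAlgebra k V) :=
  Algebra.ofModule (fun r f g => by simp [mul_def]) (fun r f g => by simp [mul_def])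

/-- The coefficient of the trivial path at the vertex `t`, as a linear map. -/
def vertexCoeff (k : Type u) [Field k] (t : V) : PathAlgebra k V →ₗ[k] k :=
  (Finsupp.lapply (⟨t, t, Path.nil⟩ : Σ a b : V, Path a b) :
    ((Σ a b : V, Path a b) →₀ k) →ₗ[k] k)

theorem vertexCoeff_nil (t : V) (r : k) : vertexCoeff k t (single (Path.nil : Path t t) r) = r :=
  Finsupp.single_eq_same

theorem vertexCoeff_nil_of_ne {s t : V} (h : s ≠ t) (r : k) :
    vertexCoeff k t (single (Path.nil : Path s s) r) = 0 :=
  Finsupp.single_eq_of_ne fun e => h (congrArg Sigma.fst e).symm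

theorem vertexCoeff_of_length {a b : V} (p : Path a b) (hp : p.length ≠ 0) (t : V) (r : k) :
    vertexCoeff k t (single p r) = 0 :=
  Finsupp.single_eq_of_ne fun e => hp (by
    have := congrArg (fun x : Σ a b : V, Path a b => x.2.2.length) e
    exact this.symm)

theorem vertexCoeff_mul (t : V) (f g : PathAlgebra k V) :
    vertexCoeff k t (f * g) = vertexCoeff k t f * vertexCoeff k t g := by
  induction f using PathAlgebra.induction with
  | zero => simp
  | add f f' hf hf' => simp only [add_mul, map_add, hf, hf']
  | single q r =>
    induction g using PathAlgebra.induction with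
    | zero => simp
    | add g g' hg hg' => simp only [mul_add, map_add, hg, hg']
    | @single a b p s =>
      rename_i c d
      by_cases h : b = c
      · subst h
        rw [single_mul_single]
        by_cases hq : q.length = 0
        · obtain rfl := Path.eq_of_length_zero q hq
          obtain rfl := Path.eq_nil_of_length_zero q hq
          rw [Path.comp_nil]
          by_cases hp : p.length = 0
          · obtain rfl := Path.eq_of_length_zero p hp
            obtain rfl := Path.eq_nil_of_length_zero p hp
            by_cases hb : a = t
            · subst hb
              simp only [vertexCoeff_nil]
            · simp only [vertexCoeff_nil_of_ne hb, mul_zero]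
          · rw [vertexCoeff_of_length p hp, vertexCoeff_of_length p hp, mul_zero]
        · rw [vertexCoeff_of_length q hq, zero_mul, vertexCoeff_of_length]
          rw [Path.length_comp]
          omega
      · rw [single_mul_single_of_ne _ _ _ _ h, map_zero]
        by_cases hq : q.length = 0
        · by_cases hp : p.length = 0
          · obtain rfl := Path.eq_of_length_zero q hq
            obtain rfl := Path.eq_nil_of_length_zero q hq
            obtain rfl := Path.eq_of_length_zero p hp
            obtain rfl := Path.eq_nil_of_length_zero p hp
            by_cases hb : a = t
            · rw [vertexCoeff_nil_of_ne (fun e => h (hb.trans e.symm)), zero_mul]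
            · rw [vertexCoeff_nil_of_ne hb, mul_zero]
          · rw [vertexCoeff_of_length p hp, mul_zero]
        · rw [vertexCoeff_of_length q hq, zero_mul]

theorem vertexCoeff_one (t : V) : vertexCoeff k t (1 : PathAlgebra k V) = 1 := by
  rw [one_def, map_sum, Finset.sum_eq_single t]
  · exact vertexCoeff_nil t 1
  · intro s _ hs
    exact vertexCoeff_nil_of_ne hs 1
  · simp

/-- The coefficient of the trivial path at the vertex `t`, as an algebra homomorphism. -/
def vertexHom (k : Type u) [Field k] (t : V) : PathAlgebra k V →ₐ[k] k :=
  AlgHom.ofLinearMap (vertexCoeff k t) (vertexCoeff_one t) (vertexCoeff_mul t)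

/-- The simple module `S_t` at the vertex `t`: the space `k`, on which the trivial path at `t`
acts as the identity and all other paths act as zero. -/
def simpleAt (k : Type u) [Field k] (t : V) : FinDimMod k (PathAlgebra k V) :=
  ⟨(ModuleCat.restrictScalars (vertexHom k t).toRingHom).obj (ModuleCat.of k k), by
    let N := (ModuleCat.restrictScalars (algebraMap k (PathAlgebra k V))).obj
      ((ModuleCat.restrictScalars (vertexHom k t).toRingHom).obj (ModuleCat.of k k))
    let g : k →ₗ[k] N :=
      { toFun := fun x => (x : k)
        map_add' := fun _ _ => rfl
        map_smul' := fun c x => by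
          change c * x = vertexHom k t (algebraMap k (PathAlgebra k V) c) * x
          rw [AlgHom.commutes]
          rfl }
    exact Module.Finite.of_surjective g fun x => ⟨(x : k), rfl⟩⟩

theorem isSimpleModule_simpleAt (t : V) :
    IsSimpleModule (PathAlgebra k V) (simpleAt k t).obj := by
  have : Nontrivial (simpleAt k t).obj := inferInstanceAs (Nontrivial k)
  rw [isSimpleModule_iff_toSpanSingleton_surjective]
  refine ⟨this, fun (x : k) (hx : x ≠ 0) (y : k) =>
    ⟨single (Path.nil : Path t t) (y * x⁻¹), ?_⟩⟩
  change vertexHom k t (single (Path.nil : Path t t) (y * x⁻¹)) * x = y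
  rw [show vertexHom k t (single (Path.nil : Path t t) (y * x⁻¹)) = y * x⁻¹ from
    vertexCoeff_nil t _]
  exact inv_mul_cancel_right₀ hx y

end PathAlgebra

end PathAlgebra

/-! ## The linearly oriented quiver of type `A` and the algebra `A_n` -/

/-- The vertices `1, …, n` of the quiver `Q_n`. -/
@[ext]
structure QVertex (n : ℕ) : Type where
  /-- the number of the vertex -/
  val : ℕ
  one_le : 1 ≤ val
  le_n : val ≤ n

instance (n : ℕ) : Fintype (QVertex n) :=
  Fintype.ofInjective (fun i => (⟨i.val, Nat.lt_succ_of_le i.le_n⟩ : Fin (n + 1)))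
    fun _ _ h => QVertex.ext (congrArg Fin.val h)

/-- The quiver `Q_n : 1 → 2 → ⋯ → n`: one arrow from `i` to `j` if `j = i + 1`, none otherwise. -/
instance (n : ℕ) : Quiver.{0} (QVertex n) := ⟨fun i j => PLift (j.val = i.val + 1)⟩

/-- The monoid `M(Q_n)` of projection functors of the path algebra `k Q_n`. -/
abbrev QMonoid (k : Type u) [Field k] (n : ℕ) : Type (u + 1) :=
  projMonoid k (PathAlgebra k (QVertex n))

/-- The class `p_t` in `M(Q_n)` of the projection functor of the simple module `S_t`. -/
def pVertex (k : Type u) [Field k] {n : ℕ} (t : QVertex n) : QMonoid k n :=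
  ⟨EndoClass.mk (projFunctor k _ (PathAlgebra.simpleAt k t)),
    Submonoid.subset_closure ⟨_, PathAlgebra.isSimpleModule_simpleAt t, rfl⟩⟩

/-- The monoid algebra `A_n = R M(Q_n)`, for the projection functors over the field `k`. -/
abbrev QAlgebra (k : Type u) [Field k] (R : Type v) [Field R] (n : ℕ) : Type (max v (u + 1)) :=
  MonoidAlgebra R (QMonoid k n)

/-- The generator `p_t` of the algebra `A_n`. -/
def pGen (k : Type u) [Field k] (R : Type v) [Field R] {n : ℕ} (t : QVertex n) :
    QAlgebra k R n :=
  MonoidAlgebra.of R (QMonoid k n) (pVertex k t)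

/-! ## The poset `P_n` and its incidence algebra -/

/-- The subsets of `{1, …, n}`. -/
@[ext]
structure ProdPoset (n : ℕ) where
  /-- the underlying finite set -/
  set : Finset ℕ
  /-- it consists of numbers from `1` to `n` -/
  subset : set ⊆ Finset.Icc 1 n

namespace ProdPoset

variable {n : ℕ}

/-- The elements of a subset in increasing order. -/
def list (J : ProdPoset n) : List ℕ := J.set.sort

/-- The product order: `{j₁ < ⋯ < j_m} ≤ {k₁ < ⋯ < k_r}` if and only if `m = r` and `j_i ≤ k_i`
for all `i`. -/
instance : PartialOrder (ProdPoset n) where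
  le J K := List.Forall₂ (· ≤ ·) J.list K.list
  le_refl _ := List.forall₂_refl _
  le_trans I J K h h' := by
    have key : ∀ l₁ l₂ l₃ : List ℕ, List.Forall₂ (· ≤ ·) l₁ l₂ → List.Forall₂ (· ≤ ·) l₂ l₃ →
        List.Forall₂ (· ≤ ·) l₁ l₃ := by
      intro l₁ l₂ l₃ h
      induction h generalizing l₃ with
      | nil => exact id
      | cons hab _ ih =>
        rintro (_ | ⟨hbc, h'⟩)
        exact .cons (hab.trans hbc) (ih _ h')
    exact key _ _ _ h h'
  le_antisymm J K h h' := by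
    have key : ∀ l₁ l₂ : List ℕ, List.Forall₂ (· ≤ ·) l₁ l₂ → List.Forall₂ (· ≤ ·) l₂ l₁ →
        l₁ = l₂ := by
      intro l₁ l₂ h
      induction h with
      | nil => exact fun _ => rfl
      | cons hab _ ih =>
        rintro (_ | ⟨hba, h'⟩)
        exact congrArg₂ List.cons (hab.antisymm hba) (ih h')
    have := congrArg List.toFinset (key _ _ h h')
    simp only [list, Finset.sort_toFinset] at this
    exact ProdPoset.ext this

instance : Finite (ProdPoset n) :=
  Finite.of_injective
    (fun J => (⟨J.set, Finset.mem_powerset.2 J.subset⟩ : (Finset.Icc 1 n).powerset))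
    fun _ _ h => ProdPoset.ext (congrArg Subtype.val h)

instance : DecidableEq (ProdPoset n) := Classical.decEq _

open scoped Classical in
instance : LocallyFiniteOrder (ProdPoset n) :=
  letI := Fintype.ofFinite (ProdPoset n)
  Fintype.toLocallyFiniteOrder

end ProdPoset

/-- The incidence algebra of `P_n`, with basis the `X_(K,J)` for `K ≥ J`.  Mathlib's incidence
algebra has a basis element for each pair `a ≤ b`, hence the dual order. -/
abbrev IncAlgebra (R : Type v) [Field R] (n : ℕ) : Type v :=
  IncidenceAlgebra R (ProdPoset n)ᵒᵈ

/-- The basis element `X_(K,J)` of the incidence algebra, for `K ≥ J`. -/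
def incX (R : Type v) [Field R] {n : ℕ} (K J : ProdPoset n) (h : J ≤ K) : IncAlgebra R n where
  toFun a b := if a = OrderDual.toDual K ∧ b = OrderDual.toDual J then 1 else 0
  eq_zero_of_not_le' a b hab := if_neg fun e => hab (by
    rw [e.1, e.2]
    exact h)

/-! ## The elements `y`, `z`, `g`, `f` and `p_(K,J)` -/

section Elements

variable {A : Type*} [Ring A] {n : ℕ} (p : QVertex n → A)

/-- The element `p_m` for `1 ≤ m ≤ n` (and `1` for other `m`, which do not occur below). -/
def pAt (m : ℕ) : A := if h : 1 ≤ m ∧ m ≤ n then p ⟨m, h.1, h.2⟩ else 1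

/-- The element `y_k^m` for `1 ≤ k` and `m ≤ n`. -/
def yElt : ℕ → ℕ → A
  | 0, _ => 0
  | m + 1, k =>
    if m + 1 < k then 0
    else if k = 1 then yElt m 1 - pAt p (m + 1) * yElt m 1 + pAt p (m + 1)
    else yElt m k - pAt p (m + 1) * yElt m k + yElt m (k - 1) * pAt p (m + 1)

/-- The element `z_k = y_k^n - y_(k+1)^n`, where `y_0^n` is read as `1`. -/
def zElt (k : ℕ) : A :=
  if k = 0 then 1 - yElt p n 1 else yElt p n k - yElt p n (k + 1)

/-- The element `g_J^m` for a non-empty subset `J` of `{1, …, m}` and `m ≤ n`. -/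
def gElt : ℕ → Finset ℕ → A
  | 0, _ => 0
  | m + 1, J =>
    if m + 1 ∉ J then gElt m J - pAt p (m + 1) * gElt m J
    else if J = {m + 1} then pAt p (m + 1)
    else gElt m (J.erase (m + 1)) * pAt p (m + 1)

/-- The idempotent `f_J`. -/
def fElt (J : ProdPoset n) : A :=
  if J.set = ∅ then zElt p 0 else gElt p n J.set * zElt p J.set.card

/-- The word `k, k - 1, …, j + 1, j`, for `k ≥ j`. -/
def descWord (k j : ℕ) : List ℕ := (List.range' j (k + 1 - j)).reverse

/-- The monomial `p_(K,J)` of the concatenation of the words from `k_i` down to `j_i`, for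
`i = 1, …, r`, where `K = {k₁ < ⋯ < k_r}` and `J = {j₁ < ⋯ < j_r}`. -/
def pMonomial (K J : ProdPoset n) : A :=
  ((List.zipWith descWord K.list J.list).flatten.map (pAt p)).prod

end Elements

end

/-!
The proof realises both sides of the isomorphism by matrices indexed by the subsets of
`{1, …, n}`.

*The monoid.*  Let `θ` be an order-preserving self-map of `{0, …, n}` with `θ j ≤ j`.  In every
module `M` the elements killed by all paths `i → j` with `i ≤ θ j` form a submodule
(`pathKernel`), and the quotients by these submodules are functors `F_θ`.  A path `i → j` with
`i ≤ θ (η j)` factors over the vertex `η j`, whence `F_θ ∘ F_η ≅ F_(θη)` (`catalanFunctor`).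
For the map `θ` that only lowers `t` to `t - 1`, the functor `F_θ` is the projection functor of
`S_t` (`genSubmodule_simpleAt`), and every simple module is some `S_t`.  The regular module
detects the value `θ n`, and composition with truncations moves every value of `θ` to `n`, so the
`F_θ` are pairwise non-isomorphic (`catalanFunctor_injective`).  Thus `M(Q_n)` embeds into the
Catalan monoid of all `θ`, with `p_t` going to the map that lowers `t`.

*The representation.*  The Catalan monoid acts on the subsets of `{1, …, n}` through their
complements: `θ` carries `J` to `K` if it maps the complement of `J` bijectively onto the
complement of `K`, and sends `J` to zero if there is no such `K`.  As `θ` is decreasing, `K ≥ J`,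
so this is a representation by elements of the incidence algebra (`catalanRep`).  It is faithful
on monoid algebras: `θ` is the smallest element that moves the positions where `θ` increases in
the way `θ` does, so in a linear combination a maximal `θ` has a matrix entry of its own
(`algRep_injective`).

*The elements.*  In the representation, `y_k^m` is the projection onto the subsets with at least
`k` elements in `{1, …, m}` (`yElt_incGen`), and `z_k` the projection onto those with `k` elements.
The map of the monomial `p_(K,J)` misses exactly `K`, and it identifies `x` with `x - 1` exactly
for `x ∈ J` (`CatalanMonoid.ofPair_spec`).  Hence on subsets with `|J|` elements its matrix is
`X_(K,J) E` for a matrix `E` that is the same for all `K` and `J` (`pMonomial_mul_cardDiag`).  Since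
`f_J` is a left multiple of `p_(J,J) z_|J|`, its matrix is `U X_(J,J) E` for a matrix `U`.  The
`g_J^m` with `|J| = k` sum up to `y_k^m` (`sum_gElt`), so the `f_J` sum up to `1`, that is
`U E = 1`.  It follows that `f_K p_(K,J) f_J` has the matrix `U X_(K,J) U⁻¹`
(`fElt_mul_pMonomial_mul_fElt_incGen`).  So the representation is bijective, and `Φ` is the
conjugation by `U` followed by the inverse of the representation.

The polynomials `c_(K,J)` are the same expressions in the generators of the free ring.
-/

noncomputable section

/-! ### The Catalan monoid -/

/-- Order-preserving maps `θ` of `{0, …, n}` with `θ j ≤ j` for all `j`, encoded as maps of `ℕ`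
that fix every `j > n`. -/
def catalanSubmonoid (n : ℕ) : Submonoid (ℕ →o ℕ) where
  carrier := {θ | ∀ j, θ j ≤ j ∧ (n < j → θ j = j)}
  one_mem' := fun _ => ⟨le_rfl, fun _ => rfl⟩
  mul_mem' hθ hη j := ⟨(hθ _).1.trans (hη j).1,
    fun hj => (congrArg _ ((hη j).2 hj)).trans ((hθ j).2 hj)⟩

/-- The Catalan monoid: decreasing order-preserving self-maps of `{0, …, n}` under composition. -/
abbrev CatalanMonoid (n : ℕ) : Type := catalanSubmonoid n

namespace CatalanMonoid

variable {n : ℕ}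

instance : FunLike (CatalanMonoid n) ℕ ℕ where
  coe θ := θ.1
  coe_injective _ _ h := Subtype.ext (OrderHom.ext _ _ h)

@[ext]
theorem ext {θ η : CatalanMonoid n} (h : ∀ j, θ j = η j) : θ = η :=
  DFunLike.ext _ _ h

theorem mul_apply (θ η : CatalanMonoid n) (j : ℕ) : (θ * η) j = θ (η j) := rfl

theorem mono (θ : CatalanMonoid n) : Monotone θ := θ.1.monotone

theorem apply_le (θ : CatalanMonoid n) (j : ℕ) : θ j ≤ j := (θ.2 j).1

theorem apply_of_lt (θ : CatalanMonoid n) {j : ℕ} (hj : n < j) : θ j = j := (θ.2 j).2 hj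

theorem apply_zero (θ : CatalanMonoid n) : θ 0 = 0 := Nat.le_zero.1 (θ.apply_le 0)

/-- The generator of the Catalan monoid that lowers `t` to `t - 1` and fixes everything else. -/
def gen (t : QVertex n) : CatalanMonoid n :=
  ⟨⟨fun j => if j = t.val then j - 1 else j, fun a b hab => by
      dsimp only
      split_ifs <;> omega⟩, fun j => by
    have := t.le_n
    refine ⟨?_, fun hj => ?_⟩
    · change (if j = t.val then j - 1 else j) ≤ j
      split_ifs <;> omega
    · exact if_neg (by omega)⟩

theorem gen_apply (t : QVertex n) (j : ℕ) : gen t j = if j = t.val then j - 1 else j := rfl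

/-- The element `j ↦ min c j` on `{0, …, n}`. -/
def trunc (n c : ℕ) : CatalanMonoid n :=
  ⟨⟨fun j => if j ≤ n then min c j else j, fun a b hab => by
      dsimp only
      split_ifs <;> omega⟩, fun j => by
    change (if j ≤ n then min c j else j) ≤ j ∧ (n < j → (if j ≤ n then min c j else j) = j)
    split_ifs <;> omega⟩

theorem trunc_apply (c j : ℕ) : trunc n c j = if j ≤ n then min c j else j := rfl

end CatalanMonoid

/-! ### Complements and the product order -/

namespace ProdPoset

variable {n : ℕ}

instance : Fintype (ProdPoset n) := Fintype.ofFinite _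

/-- The complement of a subset in `{1, …, n}`. -/
def compl (J : ProdPoset n) : Finset ℕ := Finset.Icc 1 n \ J.set

/-- The element of `P_n` with a given complement. -/
def ofCompl (n : ℕ) (C : Finset ℕ) : ProdPoset n := ⟨Finset.Icc 1 n \ C, Finset.sdiff_subset⟩

theorem compl_ofCompl {C : Finset ℕ} (hC : C ⊆ Finset.Icc 1 n) : (ofCompl n C).compl = C := by
  rw [compl, ofCompl, Finset.sdiff_sdiff_eq_self hC]

theorem compl_injective : Function.Injective (compl : ProdPoset n → Finset ℕ) := by
  intro J K h
  apply ProdPoset.ext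
  rw [← Finset.sdiff_sdiff_eq_self J.subset, ← Finset.sdiff_sdiff_eq_self K.subset]
  exact congrArg _ h

theorem mem_compl {J : ProdPoset n} {x : ℕ} : x ∈ J.compl ↔ (1 ≤ x ∧ x ≤ n) ∧ x ∉ J.set := by
  rw [compl, Finset.mem_sdiff, Finset.mem_Icc]

theorem one_le_of_mem {J : ProdPoset n} {x : ℕ} (h : x ∈ J.set) : 1 ≤ x :=
  (Finset.mem_Icc.1 (J.subset h)).1

theorem le_of_mem {J : ProdPoset n} {x : ℕ} (h : x ∈ J.set) : x ≤ n :=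
  (Finset.mem_Icc.1 (J.subset h)).2

theorem card_eq_of_le {J K : ProdPoset n} (h : J ≤ K) : J.set.card = K.set.card := by
  have := List.Forall₂.length_eq (show List.Forall₂ (· ≤ ·) J.list K.list from h)
  simpa [list] using this

/-- Sorted lists are comparable entry by entry if below each bound the first one has at least as
many entries as the second. -/
theorem forall₂_le_of_countP {l₁ l₂ : List ℕ} (h₁ : l₁.SortedLT) (h₂ : l₂.SortedLT)
    (hl : l₁.length = l₂.length)
    (hc : ∀ t, l₂.countP (· ≤ t) ≤ l₁.countP (· ≤ t)) : List.Forall₂ (· ≤ ·) l₁ l₂ := by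
  induction l₁ generalizing l₂ with
  | nil =>
    obtain rfl := List.length_eq_zero_iff.1 hl.symm
    exact .nil
  | cons a l ih =>
    cases l₂ with
    | nil => simp at hl
    | cons b l' =>
      have h₁' := List.pairwise_cons.1 h₁.pairwise
      have h₂' := List.pairwise_cons.1 h₂.pairwise
      have hab : a ≤ b := by
        by_contra hlt
        have := hc b
        have h0 : (a :: l).countP (· ≤ b) = 0 := by
          rw [List.countP_eq_zero]
          intro x hx
          have : a ≤ x := by
            rcases List.mem_cons.1 hx with rfl | hx
            · exact le_rfl
            · exact (h₁'.1 x hx).le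
          simp only [decide_eq_true_eq]
          omega
        rw [h0, List.countP_cons_of_pos (by simp)] at this
        omega
      refine .cons hab (ih h₁'.2.sortedLT h₂'.2.sortedLT (by simpa using hl) fun t => ?_)
      have := hc t
      by_cases hbt : b ≤ t
      · rw [List.countP_cons_of_pos (by simpa using hbt),
          List.countP_cons_of_pos (by simp only [decide_eq_true_eq]; omega)] at this
        omega
      · have h0 : l'.countP (· ≤ t) = 0 := by
          rw [List.countP_eq_zero]
          intro x hx
          have := h₂'.1 x hx
          simp only [decide_eq_true_eq]
          omega
        omega

theorem countP_list (J : ProdPoset n) (t : ℕ) :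
    J.list.countP (· ≤ t) = (J.set.filter (· ≤ t)).card := by
  have hnd : J.list.Nodup := Finset.sort_nodup _ _
  rw [List.countP_eq_length_filter, ← List.toFinset_card_of_nodup (hnd.filter _)]
  congr 1
  ext x
  simp [list]

/-- The product order in terms of the numbers of elements below each bound. -/
theorem le_of_card_filter {J K : ProdPoset n} (hcard : J.set.card = K.set.card)
    (h : ∀ t, (K.set.filter (· ≤ t)).card ≤ (J.set.filter (· ≤ t)).card) : J ≤ K := by
  refine forall₂_le_of_countP (Finset.sortedLT_sort _) (Finset.sortedLT_sort _) ?_ fun t => ?_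
  · simpa [list] using hcard
  · exact (countP_list K t).trans_le ((h t).trans (countP_list J t).ge)

theorem card_compl (J : ProdPoset n) : J.compl.card + J.set.card = n := by
  have := Finset.card_sdiff_add_card_eq_card J.subset
  simpa [compl] using this

theorem card_filter_compl (J : ProdPoset n) (t : ℕ) :
    (J.compl.filter (· ≤ t)).card + (J.set.filter (· ≤ t)).card =
      ((Finset.Icc 1 n).filter (· ≤ t)).card := by
  rw [← Finset.card_union_of_disjoint]
  · congr 1
    ext x
    have := @le_of_mem _ J x
    have := @one_le_of_mem _ J x
    simp only [Finset.mem_union, Finset.mem_filter, mem_compl, Finset.mem_Icc]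
    tauto
  · rw [Finset.disjoint_left]
    intro x hx hx'
    exact (mem_compl.1 (Finset.mem_filter.1 hx).1).2 (Finset.mem_filter.1 hx').1

/-- A decreasing injective map of complements makes subsets larger in the product order. -/
theorem le_of_image_compl {J K : ProdPoset n} (θ : CatalanMonoid n) (hinj : Set.InjOn θ J.compl)
    (himg : J.compl.image θ = K.compl) : J ≤ K := by
  have hc : J.compl.card = K.compl.card := by
    rw [← himg, Finset.card_image_of_injOn hinj]
  have hJ := J.card_compl
  have hK := K.card_compl
  refine le_of_card_filter (by omega) fun t => ?_
  have hJt := J.card_filter_compl t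
  have hKt := K.card_filter_compl t
  have : (J.compl.filter (· ≤ t)).card ≤ (K.compl.filter (· ≤ t)).card := by
    refine Finset.card_le_card_of_injOn θ ?_ (hinj.mono fun x hx => (Finset.mem_filter.1 hx).1)
    intro x hx
    obtain ⟨hx, hxt⟩ := Finset.mem_filter.1 hx
    refine Finset.mem_coe.2 (Finset.mem_filter.2 ⟨?_, (θ.apply_le x).trans hxt⟩)
    rw [← himg]
    exact Finset.mem_image_of_mem _ hx
  omega

end ProdPoset

/-! ### The representation on complements of subsets -/

section IncRep

open ProdPoset

variable {n : ℕ}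

/-- `θ` maps the complement of `J` bijectively onto the complement of `K`. -/
def CatalanMonoid.Carries (θ : CatalanMonoid n) (J K : ProdPoset n) : Prop :=
  Set.InjOn θ J.compl ∧ J.compl.image θ = K.compl

theorem CatalanMonoid.carries_one {J K : ProdPoset n} :
    (1 : CatalanMonoid n).Carries J K ↔ K = J := by
  have h : J.compl.image (1 : CatalanMonoid n) = J.compl := Finset.image_id
  rw [Carries, h]
  exact ⟨fun e => (compl_injective e.2).symm, fun e => ⟨fun _ _ _ _ h => h, e ▸ rfl⟩⟩

theorem CatalanMonoid.Carries.unique {θ : CatalanMonoid n} {J K L : ProdPoset n}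
    (h : θ.Carries J K) (h' : θ.Carries J L) : K = L :=
  compl_injective (h.2.symm.trans h'.2)

theorem CatalanMonoid.carries_mul {θ η : CatalanMonoid n} {J K : ProdPoset n} :
    (θ * η).Carries J K ↔ ∃ L, η.Carries J L ∧ θ.Carries L K := by
  have him : J.compl.image (θ * η) = (J.compl.image η).image θ := by
    rw [Finset.image_image]; rfl
  constructor
  · rintro ⟨hinj, himg⟩
    have hsub : J.compl.image η ⊆ Finset.Icc 1 n := by
      intro y hy
      obtain ⟨x, hx, rfl⟩ := Finset.mem_image.1 hy
      refine Finset.mem_Icc.2 ⟨Nat.one_le_iff_ne_zero.2 fun h0 => ?_,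
        (η.apply_le x).trans (mem_compl.1 hx).1.2⟩
      have : (θ * η) x ∈ K.compl := himg ▸ Finset.mem_image_of_mem _ hx
      rw [mul_apply, h0, apply_zero] at this
      exact absurd (mem_compl.1 this).1.1 (by omega)
    have hc := compl_ofCompl hsub
    have hη : Set.InjOn η J.compl := fun x hx y hy h => hinj hx hy (congrArg θ h)
    refine ⟨ofCompl n (J.compl.image η), ⟨hη, hc.symm⟩, ?_, by rw [hc, ← him, himg]⟩
    rw [hc]
    intro a ha b hb hab
    obtain ⟨x, hx, rfl⟩ := Finset.mem_image.1 (Finset.mem_coe.1 ha)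
    obtain ⟨y, hy, rfl⟩ := Finset.mem_image.1 (Finset.mem_coe.1 hb)
    exact congrArg η (hinj hx hy hab)
  · rintro ⟨L, ⟨hinj, himg⟩, hinj', himg'⟩
    refine ⟨fun x hx y hy h => hinj hx hy (hinj' ?_ ?_ h), by rw [him, himg, himg']⟩
    · exact himg ▸ Finset.mem_image_of_mem _ hx
    · exact himg ▸ Finset.mem_image_of_mem _ hy

/-- The entry of an element of the incidence algebra at `(K, J)`. -/
def entry {R : Type v} [Field R] (f : IncAlgebra R n) (K J : ProdPoset n) : R :=
  f (OrderDual.toDual K) (OrderDual.toDual J)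

variable {R : Type v} [Field R]

theorem entry_ext {f g : IncAlgebra R n} (h : ∀ K J, entry f K J = entry g K J) : f = g :=
  IncidenceAlgebra.ext fun a b _ => h (OrderDual.ofDual a) (OrderDual.ofDual b)

theorem le_of_entry_ne_zero {f : IncAlgebra R n} {K J : ProdPoset n} (h : entry f K J ≠ 0) :
    J ≤ K := by
  by_contra hc
  exact h (IncidenceAlgebra.apply_eq_zero_of_not_le
    (a := OrderDual.toDual K) (b := OrderDual.toDual J) hc f)

theorem entry_add (f g : IncAlgebra R n) (K J : ProdPoset n) :
    entry (f + g) K J = entry f K J + entry g K J := rfl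

theorem entry_sub (f g : IncAlgebra R n) (K J : ProdPoset n) :
    entry (f - g) K J = entry f K J - entry g K J := rfl

theorem entry_smul (r : R) (f : IncAlgebra R n) (K J : ProdPoset n) :
    entry (r • f) K J = r * entry f K J := rfl

theorem entry_zero (K J : ProdPoset n) : entry (0 : IncAlgebra R n) K J = 0 := rfl

theorem entry_one (K J : ProdPoset n) :
    entry (1 : IncAlgebra R n) K J = if K = J then 1 else 0 := by
  rw [entry, IncidenceAlgebra.one_apply]
  rfl

/-- The entries as an additive homomorphism. -/
def entryHom (K J : ProdPoset n) : IncAlgebra R n →+ R where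
  toFun f := entry f K J
  map_zero' := rfl
  map_add' _ _ := rfl

theorem entry_sum {ι : Type*} (s : Finset ι) (f : ι → IncAlgebra R n) (K J : ProdPoset n) :
    entry (∑ i ∈ s, f i) K J = ∑ i ∈ s, entry (f i) K J :=
  map_sum (entryHom K J) f s

/-- The product in the incidence algebra is the matrix product. -/
theorem entry_mul (f g : IncAlgebra R n) (K J : ProdPoset n) :
    entry (f * g) K J = ∑ L, entry f K L * entry g L J := by
  rw [entry, IncidenceAlgebra.mul_apply]
  refine (Finset.sum_subset (Finset.subset_univ _) fun x _ hx => ?_).trans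
    (Fintype.sum_equiv OrderDual.ofDual _ _ fun x => rfl)
  rw [Finset.mem_Icc, not_and_or] at hx
  rcases hx with hx | hx
  · rw [IncidenceAlgebra.apply_eq_zero_of_not_le hx, zero_mul]
  · rw [IncidenceAlgebra.apply_eq_zero_of_not_le hx, mul_zero]

theorem entry_incX {K J : ProdPoset n} (h : J ≤ K) (K' J' : ProdPoset n) :
    entry (incX R K J h) K' J' = if K' = K ∧ J' = J then 1 else 0 := rfl

open scoped Classical in
/-- Every element of the incidence algebra is a combination of the basis elements. -/
theorem span_incX : Submodule.span R
    {f : IncAlgebra R n | ∃ (K J : ProdPoset n) (h : J ≤ K), f = incX R K J h} = ⊤ := by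
  rw [eq_top_iff]
  intro f _
  have : f = ∑ K, ∑ J, if h : J ≤ K then entry f K J • incX R K J h else 0 := by
    refine entry_ext fun K J => ?_
    rw [entry_sum, Finset.sum_eq_single K, entry_sum, Finset.sum_eq_single J]
    · split_ifs with h
      · rw [entry_smul, entry_incX, if_pos ⟨rfl, rfl⟩, mul_one]
      · by_contra h0
        exact h (le_of_entry_ne_zero h0)
    · intro L _ hL
      split_ifs with h
      · rw [entry_smul, entry_incX, if_neg (fun e => hL e.2.symm), mul_zero]
      · rfl
    · simp
    · intro L _ hL
      rw [entry_sum]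
      refine Finset.sum_eq_zero fun I _ => ?_
      split_ifs with h
      · rw [entry_smul, entry_incX, if_neg (fun e => hL e.1.symm), mul_zero]
      · rfl
    · simp
  rw [this]
  refine Submodule.sum_mem _ fun K _ => Submodule.sum_mem _ fun J _ => ?_
  split_ifs with h
  · exact Submodule.smul_mem _ _ (Submodule.subset_span ⟨K, J, h, rfl⟩)
  · exact Submodule.zero_mem _

variable (n R)

open scoped Classical in
/-- The representation of the Catalan monoid by matrices with entries `0` and `1`: the column of
`θ` at `J` is the subset with complement `θ(Jᶜ)` if `θ` is injective and non-zero on `Jᶜ`, and zero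
otherwise. -/
def catalanRep : CatalanMonoid n →* IncAlgebra R n where
  toFun θ :=
    { toFun := fun a b => if θ.Carries (OrderDual.ofDual b) (OrderDual.ofDual a) then 1 else 0
      eq_zero_of_not_le' := fun a b hab =>
        if_neg fun e => hab (le_of_image_compl θ e.1 e.2) }
  map_one' := by
    refine entry_ext fun K J => ?_
    rw [entry_one]
    exact if_congr CatalanMonoid.carries_one rfl rfl
  map_mul' θ η := by
    refine entry_ext fun K J => ?_
    rw [entry_mul]
    change (if (θ * η).Carries J K then (1 : R) else 0) =
      ∑ L, (if θ.Carries L K then 1 else 0) * (if η.Carries J L then 1 else 0)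
    simp only [← ite_and, mul_ite, mul_one, mul_zero]
    split_ifs with h
    · obtain ⟨L, h1, h2⟩ := CatalanMonoid.carries_mul.1 h
      rw [Finset.sum_eq_single L, if_pos ⟨h1, h2⟩]
      · intro M _ hM
        exact if_neg fun e => hM (e.1.unique h1)
      · simp
    · exact (Finset.sum_eq_zero fun L _ => if_neg fun e =>
        h (CatalanMonoid.carries_mul.2 ⟨L, e⟩)).symm

variable {n R}

open scoped Classical in
theorem entry_catalanRep (θ : CatalanMonoid n) (K J : ProdPoset n) :
    entry (catalanRep n R θ) K J = if θ.Carries J K then 1 else 0 := rfl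

/-- The positions at which `θ` increases. -/
def CatalanMonoid.jumps (θ : CatalanMonoid n) : Finset ℕ :=
  (Finset.Icc 1 n).filter fun x => θ x ≠ θ (x - 1)

theorem CatalanMonoid.strictMonoOn_jumps (θ : CatalanMonoid n) :
    StrictMonoOn θ (θ.jumps : Set ℕ) := by
  intro x _ y hy hxy
  have hy' := (Finset.mem_filter.1 (Finset.mem_coe.1 hy)).2
  have h1 : θ x ≤ θ (y - 1) := θ.mono (by omega)
  have h2 : θ (y - 1) ≤ θ y := θ.mono (by omega)
  omega

/-- `θ` is the smallest element of the Catalan monoid with given values on the jumps of `θ`. -/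
theorem CatalanMonoid.le_of_eqOn_jumps {θ η : CatalanMonoid n} (h : ∀ x ∈ θ.jumps, θ x = η x)
    (x : ℕ) : θ x ≤ η x := by
  induction x with
  | zero => rw [apply_zero]; omega
  | succ x ih =>
    by_cases hx : x + 1 ≤ n
    · by_cases hj : θ (x + 1) = θ x
      · rw [hj]
        exact ih.trans (η.mono (Nat.le_succ x))
      · exact (h _ (Finset.mem_filter.2 ⟨Finset.mem_Icc.2 ⟨by omega, hx⟩, hj⟩)).le
    · rw [apply_of_lt _ (by omega), apply_of_lt _ (by omega)]

theorem eqOn_of_strictMonoOn_of_image_eq {C : Finset ℕ} {f g : ℕ → ℕ} (hf : StrictMonoOn f C)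
    (hg : StrictMonoOn g C) (h : C.image f = C.image g) : ∀ x ∈ C, f x = g x := by
  have hf' : StrictMono fun x : C => f x := fun x y hxy => hf x.2 y.2 hxy
  have hg' : StrictMono fun x : C => g x := fun x y hxy => hg x.2 y.2 hxy
  have : Set.range (fun x : C => f x) = Set.range (fun x : C => g x) := by
    have := congrArg (fun s : Finset ℕ => (s : Set ℕ)) h
    simp only [Finset.coe_image] at this
    rw [Set.image_eq_range, Set.image_eq_range] at this
    exact this
  intro x hx
  exact congrFun ((hf'.range_inj hg').1 this) ⟨x, hx⟩

theorem CatalanMonoid.carries_jumps (θ : CatalanMonoid n) :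
    θ.Carries (ofCompl n θ.jumps) (ofCompl n (θ.jumps.image θ)) := by
  have h1 : (ofCompl n θ.jumps).compl = θ.jumps := compl_ofCompl (Finset.filter_subset _ _)
  refine ⟨?_, ?_⟩
  · rw [h1]
    exact θ.strictMonoOn_jumps.injOn
  · rw [h1, compl_ofCompl]
    intro y hy
    obtain ⟨x, hx, rfl⟩ := Finset.mem_image.1 hy
    obtain ⟨hx, hx'⟩ := Finset.mem_filter.1 hx
    have h2 : θ (x - 1) ≤ θ x := θ.mono (by omega)
    have h3 := θ.apply_le x
    have := Finset.mem_Icc.1 hx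
    exact Finset.mem_Icc.2 ⟨by omega, by omega⟩

/-- An element that moves the jumps of `θ` like `θ` does lies above `θ`. -/
theorem CatalanMonoid.le_of_carries_jumps {θ η : CatalanMonoid n}
    (h : η.Carries (ofCompl n θ.jumps) (ofCompl n (θ.jumps.image θ))) (x : ℕ) : θ x ≤ η x := by
  have h1 : (ofCompl n θ.jumps).compl = θ.jumps := compl_ofCompl (Finset.filter_subset _ _)
  refine le_of_eqOn_jumps (eqOn_of_strictMonoOn_of_image_eq θ.strictMonoOn_jumps ?_ ?_) x
  · have := h.1
    rw [h1] at this
    exact (η.mono.monotoneOn _).strictMonoOn_of_injOn this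
  · have := θ.carries_jumps.2.trans h.2.symm
    rwa [h1] at this

variable (R) in
/-- The matrix representation of the algebra of a monoid that maps to the Catalan monoid. -/
def algRep {M : Type*} [Monoid M] (ρ : M →* CatalanMonoid n) :
    MonoidAlgebra R M →ₐ[R] IncAlgebra R n :=
  MonoidAlgebra.lift R (IncAlgebra R n) M ((catalanRep n R).comp ρ)

theorem algRep_of {M : Type*} [Monoid M] (ρ : M →* CatalanMonoid n) (m : M) :
    algRep R ρ (MonoidAlgebra.of R M m) = catalanRep n R (ρ m) :=
  MonoidAlgebra.lift_of _ _

theorem algRep_injective {M : Type*} [Monoid M] {ρ : M →* CatalanMonoid n}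
    (hρ : Function.Injective ρ) : Function.Injective (algRep R ρ) := by
  classical
  rw [injective_iff_map_eq_zero]
  intro a ha
  by_contra h0
  -- a maximal element of the support is detected by the matrix entry at its own jumps
  obtain ⟨m, hm, hmax⟩ := a.coeff.support.exists_maximalFor (fun m => (ρ m).1)
    (Finsupp.support_nonempty_iff.2 fun e => h0 (MonoidAlgebra.coeff_injective e))
  set θ := ρ m
  have key : entry (algRep R ρ a) (ofCompl n (θ.jumps.image θ)) (ofCompl n θ.jumps) =
      a.coeff m := by
    rw [algRep, MonoidAlgebra.lift_apply, Finsupp.sum, entry_sum, Finset.sum_eq_single m]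
    · rw [entry_smul]
      change _ * entry (catalanRep n R θ) _ _ = _
      rw [entry_catalanRep, if_pos θ.carries_jumps, mul_one]
    · intro m' hm' hne
      rw [entry_smul]
      change _ * entry (catalanRep n R (ρ m')) _ _ = _
      rw [entry_catalanRep, if_neg, mul_zero]
      intro hc
      have hle : θ.1 ≤ (ρ m').1 := CatalanMonoid.le_of_carries_jumps hc
      have := le_antisymm hle (hmax hm' hle)
      exact hne (hρ (Subtype.ext this)).symm
    · intro h
      exact absurd hm h
  rw [ha, entry_zero] at key
  exact Finsupp.mem_support_iff.1 hm key.symm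

end IncRep

/-! ### Naturality of the elements under ring homomorphisms -/

section Naturality

variable {A B : Type*} [Ring A] [Ring B] {n : ℕ} (φ : A →+* B) (p : QVertex n → A)

theorem map_pAt (m : ℕ) : φ (pAt p m) = pAt (fun t => φ (p t)) m := by
  unfold pAt
  split_ifs
  · rfl
  · exact map_one φ

theorem map_yElt (m k : ℕ) : φ (yElt p m k) = yElt (fun t => φ (p t)) m k := by
  induction m generalizing k with
  | zero => exact map_zero φ
  | succ m ih =>
    simp only [yElt]
    split_ifs <;> simp only [map_zero, map_add, map_sub, map_mul, ih, map_pAt]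

theorem map_zElt (k : ℕ) : φ (zElt p k) = zElt (fun t => φ (p t)) k := by
  simp only [zElt]
  split_ifs <;> simp only [map_one, map_sub, map_yElt]

theorem map_gElt (m : ℕ) (J : Finset ℕ) : φ (gElt p m J) = gElt (fun t => φ (p t)) m J := by
  induction m generalizing J with
  | zero => exact map_zero φ
  | succ m ih =>
    simp only [gElt]
    split_ifs <;> simp only [map_sub, map_mul, ih, map_pAt]

theorem map_fElt (J : ProdPoset n) : φ (fElt p J) = fElt (fun t => φ (p t)) J := by
  simp only [fElt]
  split_ifs <;> simp only [map_mul, map_zElt, map_gElt]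

theorem map_pMonomial (K J : ProdPoset n) :
    φ (pMonomial p K J) = pMonomial (fun t => φ (p t)) K J := by
  simp only [pMonomial, map_list_prod, List.map_map]
  congr 2
  exact funext fun m => map_pAt φ p m

end Naturality

/-! ### Identities valid in every ring -/

section Identities

variable {A : Type*} [Ring A] {n : ℕ} (p : QVertex n → A)

theorem Icc_one_succ (m : ℕ) : Finset.Icc 1 (m + 1) = insert (m + 1) (Finset.Icc 1 m) := by
  ext x
  simp only [Finset.mem_insert, Finset.mem_Icc]
  omega

theorem sum_gElt (m k : ℕ) (hk : 1 ≤ k) :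
    ∑ J ∈ (Finset.Icc 1 m).powersetCard k, gElt p m J = yElt p m k := by
  induction m generalizing k with
  | zero => exact Finset.sum_const_zero
  | succ m ih =>
    obtain ⟨k, rfl⟩ := Nat.exists_eq_add_of_le' hk
    have hnot : m + 1 ∉ Finset.Icc 1 m := by simp
    have hns : ∀ {c : ℕ} {J : Finset ℕ}, J ∈ (Finset.Icc 1 m).powersetCard c → m + 1 ∉ J :=
      fun hJ h => hnot ((Finset.mem_powersetCard.1 hJ).1 h)
    rw [Icc_one_succ, Finset.powersetCard_succ_insert hnot, Finset.sum_union]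
    · have h1 : ∑ J ∈ (Finset.Icc 1 m).powersetCard (k + 1), gElt p (m + 1) J =
          yElt p m (k + 1) - pAt p (m + 1) * yElt p m (k + 1) := by
        rw [← ih _ hk, Finset.mul_sum, ← Finset.sum_sub_distrib]
        exact Finset.sum_congr rfl fun J hJ => if_pos (hns hJ)
      have h2 : ∑ J ∈ ((Finset.Icc 1 m).powersetCard k).image (insert (m + 1)),
          gElt p (m + 1) J = if k = 0 then pAt p (m + 1) else yElt p m k * pAt p (m + 1) := by
        rw [Finset.sum_image]
        · split_ifs with h0
          · subst h0
            rw [Finset.powersetCard_zero, Finset.sum_singleton]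
            simp [gElt]
          · rw [← ih _ (Nat.one_le_iff_ne_zero.2 h0), Finset.sum_mul]
            refine Finset.sum_congr rfl fun J hJ => ?_
            have hne : insert (m + 1) J ≠ {m + 1} := by
              intro e
              have hc := congrArg Finset.card e
              rw [Finset.card_insert_of_notMem (hns hJ), (Finset.mem_powersetCard.1 hJ).2,
                Finset.card_singleton] at hc
              omega
            simp only [gElt]
            rw [if_neg (by simp), if_neg hne, Finset.erase_insert (hns hJ)]
        · intro I hI J hJ h
          rw [← Finset.erase_insert (hns hI), ← Finset.erase_insert (hns hJ)]
          exact congrArg (fun s => Finset.erase s (m + 1)) h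
      rw [h1, h2]
      simp only [yElt]
      by_cases hlt : m + 1 < k + 1
      · rw [if_pos hlt, if_neg (by omega), ← ih _ hk, ← ih k (by omega),
          Finset.powersetCard_eq_empty.2 (by simpa using (by omega : m < k + 1)),
          Finset.powersetCard_eq_empty.2 (by simpa using (by omega : m < k))]
        simp
      · rw [if_neg hlt]
        by_cases h0 : k = 0
        · subst h0
          simp
        · rw [if_neg h0, if_neg (by omega), Nat.add_sub_cancel]
    · rw [Finset.disjoint_left]
      intro J hJ hJ'
      obtain ⟨I, _, rfl⟩ := Finset.mem_image.1 hJ'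
      exact hns hJ (Finset.mem_insert_self _ _)

theorem sort_eq_sort_erase_append {m : ℕ} {J : Finset ℕ} (hJ : J ⊆ Finset.Icc 1 (m + 1))
    (hm : m + 1 ∈ J) : J.sort = (J.erase (m + 1)).sort ++ [m + 1] := by
  refine List.Perm.eq_of_pairwise (le := (· ≤ ·)) (fun _ _ _ _ => le_antisymm)
    (Finset.pairwise_sort _ _) ?_ ?_
  · rw [List.pairwise_append]
    refine ⟨Finset.pairwise_sort _ _, List.pairwise_singleton _ _, fun a ha b hb => ?_⟩
    rw [List.mem_singleton.1 hb]
    exact (Finset.mem_Icc.1 (hJ (Finset.mem_of_mem_erase ((Finset.mem_sort _).1 ha)))).2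
  · refine (List.perm_ext_iff_of_nodup (Finset.sort_nodup _ _) ?_).2 fun x => ?_
    · rw [List.nodup_append]
      refine ⟨Finset.sort_nodup _ _, List.nodup_singleton _, fun a ha b hb => ?_⟩
      rw [List.mem_singleton.1 hb]
      exact Finset.ne_of_mem_erase ((Finset.mem_sort _).1 ha)
    · simp only [Finset.mem_sort, List.mem_append, Finset.mem_erase, List.mem_singleton]
      by_cases h : x = m + 1
      · simp [h, hm]
      · simp [h]

/-- The element `g_J^m` is a left multiple of the increasing product of the `p_j`, `j ∈ J`. -/
theorem exists_gElt_eq_mul (m : ℕ) {J : Finset ℕ} (hJ : J ⊆ Finset.Icc 1 m) (hne : J.Nonempty) :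
    ∃ h : A, gElt p m J = h * (J.sort.map (pAt p)).prod := by
  induction m generalizing J with
  | zero =>
    obtain ⟨x, hx⟩ := hne
    exact absurd (Finset.mem_Icc.1 (hJ hx)) (by omega)
  | succ m ih =>
    have hsub : ∀ I : Finset ℕ, I ⊆ J → m + 1 ∉ I → I ⊆ Finset.Icc 1 m := by
      intro I hI hmI x hx
      have := Finset.mem_Icc.1 (hJ (hI hx))
      have hxm : x ≠ m + 1 := fun e => hmI (e ▸ hx)
      exact Finset.mem_Icc.2 ⟨this.1, by omega⟩
    simp only [gElt]
    split_ifs with h1 h2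
    · subst h2
      exact ⟨1, by simp⟩
    · have hm : m + 1 ∈ J := h1
      obtain ⟨h, hh⟩ := ih (hsub _ (Finset.erase_subset _ _) (Finset.notMem_erase _ _))
        (Finset.nonempty_iff_ne_empty.2 fun e => h2 (by
          rw [← Finset.insert_erase hm, e]; rfl))
      refine ⟨h, ?_⟩
      rw [hh, sort_eq_sort_erase_append hJ hm]
      simp [mul_assoc]
    · obtain ⟨h, hh⟩ := ih (hsub J subset_rfl h1) hne
      exact ⟨h - pAt p (m + 1) * h, by rw [hh, sub_mul, mul_assoc]⟩

theorem descWord_self (j : ℕ) : descWord j j = [j] := by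
  simp [descWord]

theorem pMonomial_self (J : ProdPoset n) :
    pMonomial p J J = (J.set.sort.map (pAt p)).prod := by
  rw [pMonomial, ProdPoset.list]
  congr 2
  induction J.set.sort with
  | nil => rfl
  | cons j l ih => rw [List.zipWith_cons_cons, List.flatten_cons, ih, descWord_self]; rfl

theorem exists_fElt_eq_mul (J : ProdPoset n) :
    ∃ h : A, fElt p J = h * pMonomial p J J * zElt p J.set.card := by
  rw [pMonomial_self, fElt]
  split_ifs with h0
  · exact ⟨1, by simp [h0]⟩
  · obtain ⟨h, hh⟩ := exists_gElt_eq_mul p n J.subset (Finset.nonempty_iff_ne_empty.2 h0)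
    exact ⟨h, by rw [hh]⟩

end Identities

/-! ### The elements of the Catalan monoid given by the words of pairs of subsets -/

namespace CatalanMonoid

variable {n : ℕ}

/-- The generator with number `m` for `1 ≤ m ≤ n`, and `1` for other `m`. -/
def genAt (n m : ℕ) : CatalanMonoid n := if h : 1 ≤ m ∧ m ≤ n then gen ⟨m, h.1, h.2⟩ else 1

theorem genAt_apply {m : ℕ} (h1 : 1 ≤ m) (h2 : m ≤ n) (x : ℕ) :
    genAt n m x = if x = m then x - 1 else x := by
  rw [genAt, dif_pos ⟨h1, h2⟩, gen_apply]

theorem prod_range'_reverse_apply (l j : ℕ) (h1 : 1 ≤ j) (h2 : j + l ≤ n + 1) (x : ℕ) :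
    ((List.range' j l).reverse.map (genAt n)).prod x =
      if j ≤ x ∧ x < j + l then x - 1 else x := by
  induction l generalizing j x with
  | zero =>
    rw [if_neg (by omega)]
    rfl
  | succ l ih =>
    rw [List.range'_succ, List.reverse_cons, List.map_append, List.prod_append, mul_apply,
      ih (j + 1) (by omega) (by omega), List.map_singleton, List.prod_singleton,
      genAt_apply h1 (by omega)]
    split_ifs <;> omega

theorem prod_descWord_apply {k j : ℕ} (h1 : 1 ≤ j) (hjk : j ≤ k) (h2 : k ≤ n) (x : ℕ) :
    ((descWord k j).map (genAt n)).prod x = if j ≤ x ∧ x ≤ k then x - 1 else x := by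
  rw [descWord, prod_range'_reverse_apply _ _ h1 (by omega)]
  exact if_congr (by omega) rfl rfl

/-- The product of the words `k_i, …, j_i` in the Catalan monoid. -/
def wordProd (n : ℕ) (ks js : List ℕ) : CatalanMonoid n :=
  ((List.zipWith descWord ks js).flatten.map (genAt n)).prod

theorem wordProd_cons (k j : ℕ) (ks js : List ℕ) :
    wordProd n (k :: ks) (j :: js) =
      ((descWord k j).map (genAt n)).prod * wordProd n ks js := by
  simp [wordProd]

/-- For increasing lists, the product `θ` of the words `k_i, …, j_i` is the decreasing monotone
map that misses the `k_i` and satisfies `θ x = θ (x - 1)` exactly for the `x = j_i`. -/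
theorem wordProd_spec {js ks : List ℕ} (hle : List.Forall₂ (· ≤ ·) js ks)
    (hjs : js.Pairwise (· < ·)) (hks : ks.Pairwise (· < ·)) (h1 : ∀ j ∈ js, 1 ≤ j)
    (hn : ∀ k ∈ ks, k ≤ n) :
    (∀ x, (∀ j ∈ js, x < j) → wordProd n ks js x = x) ∧
    (∀ k ∈ ks, ∀ x, wordProd n ks js x ≠ k) ∧
    (∀ x, 1 ≤ x → (wordProd n ks js x = wordProd n ks js (x - 1) ↔ x ∈ js)) := by
  induction hle with
  | nil =>
    refine ⟨fun x _ => rfl, by simp, fun x hx => ?_⟩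
    change x = x - 1 ↔ _
    simp only [List.not_mem_nil, iff_false]
    omega
  | @cons j k js ks hjk hle ih =>
    rw [List.pairwise_cons] at hjs hks
    obtain ⟨ih1, ih2, ih3⟩ := ih hjs.2 hks.2 (fun j hj => h1 j (List.mem_cons_of_mem _ hj))
      (fun k hk => hn k (List.mem_cons_of_mem _ hk))
    have hj1 : 1 ≤ j := h1 j List.mem_cons_self
    have hval : ∀ x, wordProd n (k :: ks) (j :: js) x =
        if j ≤ wordProd n ks js x ∧ wordProd n ks js x ≤ k then wordProd n ks js x - 1
        else wordProd n ks js x := fun x => by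
      rw [wordProd_cons, mul_apply, prod_descWord_apply hj1 hjk (hn k List.mem_cons_self)]
    set θ := wordProd n ks js
    have hθj : ∀ x, x ≤ j → θ x = x := fun x hx =>
      ih1 x fun j' hj' => hx.trans_lt (hjs.1 j' hj')
    refine ⟨fun x hx => ?_, fun k' hk' x => ?_, fun x hx => ?_⟩
    · have hxj := hx j List.mem_cons_self
      rw [hval, hθj x hxj.le, if_neg (by omega)]
    · rw [hval]
      rcases List.mem_cons.1 hk' with rfl | hk'
      · split_ifs <;> omega
      · have := hks.1 k' hk'
        have := ih2 k' hk' x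
        split_ifs <;> omega
    · rw [hval, hval, List.mem_cons]
      by_cases hxj : x ∈ js
      · rw [(ih3 x hx).2 hxj]
        simp [hxj]
      · have hne : θ x ≠ θ (x - 1) := fun e => hxj ((ih3 x hx).1 e)
        have hmono : θ (x - 1) ≤ θ x := θ.mono (by omega)
        simp only [hxj, or_false]
        constructor
        · intro e
          -- the block of `j` identifies only `j` with `j - 1`
          have hx' : θ x = j ∧ θ (x - 1) = j - 1 := by split_ifs at e <;> omega
          have hle := θ.apply_le x
          by_contra hxj'
          have : θ j ≤ θ (x - 1) := θ.mono (by omega)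
          rw [hθj j le_rfl] at this
          omega
        · rintro rfl
          rw [hθj x le_rfl, hθj (x - 1) (by omega)]
          split_ifs <;> omega

theorem eq_iff_forall_eq_pred (θ : CatalanMonoid n) {x y : ℕ} (hxy : x ≤ y) :
    θ x = θ y ↔ ∀ z, x < z → z ≤ y → θ z = θ (z - 1) := by
  constructor
  · intro h z hz hzy
    have h1 : θ x ≤ θ (z - 1) := θ.mono (by omega)
    have h2 : θ (z - 1) ≤ θ z := θ.mono (by omega)
    have h3 : θ z ≤ θ y := θ.mono hzy
    omega
  · intro h
    induction y, hxy using Nat.le_induction with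
    | base => rfl
    | succ y hy ih =>
      rw [ih fun z hz hzy => h z hz (by omega)]
      exact (h (y + 1) (by omega) le_rfl).symm

/-- The fibres of `θ` are determined by the `x` with `θ x = θ (x - 1)`. -/
theorem eq_iff_eq_of_eq_pred_iff {θ η : CatalanMonoid n}
    (h : ∀ x, 1 ≤ x → (θ x = θ (x - 1) ↔ η x = η (x - 1))) (x y : ℕ) :
    θ x = θ y ↔ η x = η y := by
  wlog hxy : x ≤ y generalizing x y
  · rw [eq_comm, this y x (by omega), eq_comm]
  rw [eq_iff_forall_eq_pred θ hxy, eq_iff_forall_eq_pred η hxy]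
  exact forall_congr' fun z => forall_congr' fun hz => forall_congr' fun _ => h z (by omega)

open ProdPoset

theorem carries_of_ne {θ : CatalanMonoid n} {I K : ProdPoset n} (hinj : Set.InjOn θ I.compl)
    (h0 : ∀ x ∈ I.compl, θ x ≠ 0) (hK : ∀ k ∈ K.set, ∀ x, θ x ≠ k)
    (hc : I.set.card = K.set.card) : θ.Carries I K := by
  refine ⟨hinj, Finset.eq_of_subset_of_card_le ?_ ?_⟩
  · intro y hy
    obtain ⟨x, hx, rfl⟩ := Finset.mem_image.1 hy
    exact mem_compl.2 ⟨⟨Nat.one_le_iff_ne_zero.2 (h0 x hx),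
      (θ.apply_le x).trans (mem_compl.1 hx).1.2⟩, fun h => hK _ h x rfl⟩
  · rw [Finset.card_image_of_injOn hinj]
    have := I.card_compl
    have := K.card_compl
    omega

theorem Carries.apply_ne_zero {θ : CatalanMonoid n} {I L : ProdPoset n} (h : θ.Carries I L)
    {x : ℕ} (hx : x ∈ I.compl) : θ x ≠ 0 := by
  have := (mem_compl.1 (h.2 ▸ Finset.mem_image_of_mem θ hx)).1.1
  omega

theorem Carries.card_eq {θ : CatalanMonoid n} {I L : ProdPoset n} (h : θ.Carries I L) :
    I.set.card = L.set.card :=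
  card_eq_of_le (le_of_image_compl θ h.1 h.2)

/-- If two elements have the same fibres, then they carry the same subsets, up to the subsets
they are carried to. -/
theorem Carries.transfer {θ η : CatalanMonoid n} {I J L : ProdPoset n} (h : θ.Carries I L)
    (hp : ∀ x, 1 ≤ x → (θ x = θ (x - 1) ↔ η x = η (x - 1)))
    (hJ : ∀ j ∈ J.set, ∀ x, η x ≠ j) (hc : I.set.card = J.set.card) : η.Carries I J := by
  have hfib := eq_iff_eq_of_eq_pred_iff hp
  refine carries_of_ne (fun x hx y hy e => h.1 hx hy ((hfib x y).2 e)) (fun x hx e => ?_) hJ hc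
  refine h.apply_ne_zero hx ?_
  rw [← θ.apply_zero, hfib, e, apply_zero]

/-- The element of the Catalan monoid of the monomial `p_(K,J)`. -/
def ofPair (K J : ProdPoset n) : CatalanMonoid n := wordProd n K.list J.list

theorem ofPair_spec {K J : ProdPoset n} (h : J ≤ K) :
    (∀ k ∈ K.set, ∀ x, ofPair K J x ≠ k) ∧
    (∀ x, 1 ≤ x → (ofPair K J x = ofPair K J (x - 1) ↔ x ∈ J.set)) := by
  have hmem : ∀ {I : ProdPoset n} {x : ℕ}, x ∈ I.list ↔ x ∈ I.set := fun {I x} =>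
    Finset.mem_sort _
  have := wordProd_spec (n := n) h (Finset.sortedLT_sort J.set).pairwise
    (Finset.sortedLT_sort K.set).pairwise
    (fun j hj => one_le_of_mem (hmem.1 hj)) (fun k hk => le_of_mem (hmem.1 hk))
  exact ⟨fun k hk => this.2.1 k (hmem.2 hk), fun x hx => (this.2.2 x hx).trans hmem⟩

theorem ofPair_carries_iff {K J I L : ProdPoset n} (h : J ≤ K) :
    ((ofPair K J).Carries I L ∧ I.set.card = J.set.card) ↔
      (L = K ∧ (ofPair J J).Carries I J) := by
  obtain ⟨h1, h2⟩ := ofPair_spec h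
  obtain ⟨h3, h4⟩ := ofPair_spec (le_refl J)
  constructor
  · rintro ⟨hc, hcard⟩
    refine ⟨hc.unique ?_, hc.transfer (fun x hx => (h2 x hx).trans (h4 x hx).symm) h3 hcard⟩
    exact carries_of_ne hc.1 (fun x hx => hc.apply_ne_zero hx) h1
      (hcard.trans (card_eq_of_le h))
  · rintro ⟨rfl, hc⟩
    exact ⟨hc.transfer (fun x hx => (h4 x hx).trans (h2 x hx).symm) h1
      (hc.card_eq.trans (card_eq_of_le h)), hc.card_eq⟩

theorem ofPair_carries_self (J : ProdPoset n) : (ofPair J J).Carries J J := by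
  obtain ⟨h1, h2⟩ := ofPair_spec (le_refl J)
  have hlt : ∀ x ∈ J.compl, ofPair J J (x - 1) < ofPair J J x := fun x hx => by
    have hx' := mem_compl.1 hx
    have := mt (h2 x hx'.1.1).1 hx'.2
    have : ofPair J J (x - 1) ≤ ofPair J J x := (ofPair J J).mono (by omega)
    omega
  refine carries_of_ne (StrictMonoOn.injOn fun x _ y hy hxy => ?_) (fun x hx => ?_) h1 rfl
  · exact lt_of_le_of_lt ((ofPair J J).mono (by omega)) (hlt y hy)
  · have := hlt x hx
    omega

/-- A generator `t` carries `J` to itself if `t ∈ J`; otherwise it replaces `t - 1 ∈ J` by `t`. -/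
theorem gen_carries {t : QVertex n} {J K : ProdPoset n} (h : (gen t).Carries J K) :
    (K = J ∧ t.val ∈ J.set) ∨ (K ≠ J ∧ t.val ∉ J.set ∧
      (K.set.filter (· ≤ t.val - 1)).card + 1 = (J.set.filter (· ≤ t.val - 1)).card) := by
  have ht1 := t.one_le
  have htn := t.le_n
  have hmemK : ∀ x, x ∈ K.compl ↔ ∃ y ∈ J.compl, gen t y = x := fun x => by
    rw [← h.2, Finset.mem_image]
  simp only [gen_apply] at hmemK
  by_cases htJ : t.val ∈ J.set
  · left
    refine ⟨compl_injective (Finset.ext fun x => ?_), htJ⟩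
    rw [hmemK]
    constructor
    · rintro ⟨y, hy, rfl⟩
      rwa [if_neg fun e : y = t.val => (mem_compl.1 hy).2 (e ▸ htJ)]
    · intro hx
      exact ⟨x, hx, if_neg fun e : x = t.val => (mem_compl.1 hx).2 (e ▸ htJ)⟩
  · right
    have htC : t.val ∈ J.compl := mem_compl.2 ⟨⟨ht1, htn⟩, htJ⟩
    have htK : t.val ∈ K.set := by
      by_contra hn
      obtain ⟨y, _, hy⟩ := (hmemK t.val).1 (mem_compl.2 ⟨⟨ht1, htn⟩, hn⟩)
      split_ifs at hy <;> omega
    have hpK : t.val - 1 ∈ K.compl := (hmemK _).2 ⟨t.val, htC, if_pos rfl⟩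
    have hpK' := mem_compl.1 hpK
    have hpJ : t.val - 1 ∈ J.set := by
      by_contra hn
      have hpC : t.val - 1 ∈ J.compl := mem_compl.2 ⟨hpK'.1, hn⟩
      have := h.1 htC hpC (by rw [gen_apply, gen_apply, if_pos rfl, if_neg (by omega)])
      omega
    refine ⟨fun e => htJ (e ▸ htK), htJ, ?_⟩
    have : K.set.filter (· ≤ t.val - 1) = (J.set.filter (· ≤ t.val - 1)).erase (t.val - 1) := by
      ext x
      simp only [Finset.mem_filter, Finset.mem_erase]
      by_cases hxt : x ≤ t.val - 1
      · by_cases hxp : x = t.val - 1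
        · subst hxp
          simp [hpK'.2]
        · have hx := hmemK x
          have : (∃ y ∈ J.compl, (if y = t.val then y - 1 else y) = x) ↔ x ∈ J.compl := by
            constructor
            · rintro ⟨y, hy, e⟩
              split_ifs at e
              · omega
              · exact e ▸ hy
            · intro hx
              exact ⟨x, hx, if_neg (by omega)⟩
          rw [this, mem_compl, mem_compl] at hx
          have := @one_le_of_mem _ J x
          have := @one_le_of_mem _ K x
          have : x ≤ n := by omega
          tauto
      · tauto
    rw [this]
    exact Finset.card_erase_add_one (Finset.mem_filter.2 ⟨hpJ, le_rfl⟩)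

theorem gen_carries_self {t : QVertex n} {J : ProdPoset n} (h : t.val ∈ J.set) :
    (gen t).Carries J J := by
  have hid : ∀ x ∈ J.compl, gen t x = x := fun x hx => by
    rw [gen_apply, if_neg fun e : x = t.val => (mem_compl.1 hx).2 (e ▸ h)]
  refine ⟨fun x hx y hy e => by rwa [hid x hx, hid y hy] at e, ?_⟩
  rw [Finset.image_congr (g := id) hid, Finset.image_id]

end CatalanMonoid

/-! ### The images of the elements in the incidence algebra -/

section Images

open ProdPoset CatalanMonoid

variable {n : ℕ} {R : Type v} [Field R]

/-- The diagonal element of the incidence algebra with given diagonal entries. -/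
def incDiag (d : ProdPoset n → R) : IncAlgebra R n where
  toFun a b := if a = b then d (OrderDual.ofDual a) else 0
  eq_zero_of_not_le' _ _ hab := if_neg fun e => hab e.le

theorem entry_incDiag (d : ProdPoset n → R) (K J : ProdPoset n) :
    entry (incDiag d) K J = if K = J then d K else 0 := rfl

theorem entry_incDiag_mul (d : ProdPoset n → R) (f : IncAlgebra R n) (K J : ProdPoset n) :
    entry (incDiag d * f) K J = d K * entry f K J := by
  rw [entry_mul, Finset.sum_eq_single K]
  · rw [entry_incDiag, if_pos rfl]
  · intro L _ hL
    rw [entry_incDiag, if_neg (Ne.symm hL), zero_mul]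
  · simp

theorem entry_mul_incDiag (d : ProdPoset n → R) (f : IncAlgebra R n) (K J : ProdPoset n) :
    entry (f * incDiag d) K J = entry f K J * d J := by
  rw [entry_mul, Finset.sum_eq_single J]
  · rw [entry_incDiag, if_pos rfl]
  · intro L _ hL
    rw [entry_incDiag, if_neg hL, mul_zero]
  · simp

theorem entry_incX_mul {K J : ProdPoset n} (h : J ≤ K) (f : IncAlgebra R n)
    (L I : ProdPoset n) :
    entry (incX R K J h * f) L I = if L = K then entry f J I else 0 := by
  rw [entry_mul, Finset.sum_eq_single J]
  · simp only [entry_incX, and_true, ite_mul, one_mul, zero_mul]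
  · intro M _ hM
    rw [entry_incX, if_neg fun e => hM e.2, zero_mul]
  · simp

theorem entry_mul_incX {K J : ProdPoset n} (h : J ≤ K) (f : IncAlgebra R n)
    (L I : ProdPoset n) :
    entry (f * incX R K J h) L I = if I = J then entry f L K else 0 := by
  rw [entry_mul, Finset.sum_eq_single K]
  · simp only [entry_incX, true_and, mul_ite, mul_one, mul_zero]
  · intro M _ hM
    rw [entry_incX, if_neg fun e => hM e.1, mul_zero]
  · simp

/-- The indicator of the subsets with `c` elements; it is central in the incidence algebra. -/
def cardDiag (n : ℕ) (R : Type v) [Field R] (c : ℕ) : IncAlgebra R n :=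
  incDiag fun J => if J.set.card = c then 1 else 0

theorem cardDiag_comm (c : ℕ) (f : IncAlgebra R n) : cardDiag n R c * f = f * cardDiag n R c := by
  refine entry_ext fun K J => ?_
  rw [cardDiag, entry_incDiag_mul, entry_mul_incDiag, mul_comm]
  by_cases h : entry f K J = 0
  · rw [h, zero_mul, zero_mul]
  · rw [card_eq_of_le (le_of_entry_ne_zero h)]

/-- The incidence algebra is a subalgebra of a matrix algebra, so one-sided inverses in it are
two-sided. -/
theorem inc_mul_eq_one_comm {f g : IncAlgebra R n} (h : f * g = 1) : g * f = 1 := by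
  have key : ∀ f g : IncAlgebra R n, f * g = 1 ↔
      Matrix.of (entry f) * Matrix.of (entry g) = 1 := by
    intro f g
    rw [← Matrix.ext_iff]
    constructor
    · intro h K J
      rw [Matrix.mul_apply, Matrix.one_apply, ← entry_one, ← h, entry_mul]
      rfl
    · intro h
      refine entry_ext fun K J => ?_
      rw [entry_mul, entry_one, ← Matrix.one_apply, ← h K J, Matrix.mul_apply]
      rfl
  rw [key] at h ⊢
  exact mul_eq_one_comm.1 h

variable (n R) in
/-- The images of the generators in the incidence algebra. -/
def incGen (t : QVertex n) : IncAlgebra R n := catalanRep n R (gen t)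

theorem pAt_incGen (m : ℕ) : pAt (incGen n R) m = catalanRep n R (genAt n m) := by
  unfold pAt genAt
  split_ifs
  · rfl
  · exact (map_one _).symm

theorem pMonomial_incGen (K J : ProdPoset n) :
    pMonomial (incGen n R) K J = catalanRep n R (ofPair K J) := by
  rw [pMonomial, ofPair, wordProd, map_list_prod, List.map_map]
  congr 2
  exact funext pAt_incGen

/-- The indicator of the subsets with at least `k` elements in `{1, …, m}`. -/
def initDiag (n : ℕ) (R : Type v) [Field R] (m k : ℕ) : IncAlgebra R n :=
  incDiag fun J => if k ≤ (J.set.filter (· ≤ m)).card then 1 else 0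

theorem initDiag_zero (m : ℕ) : initDiag n R m 0 = 1 := by
  refine entry_ext fun K J => ?_
  rw [initDiag, entry_incDiag, entry_one, if_pos (Nat.zero_le _)]

theorem card_filter_le_succ (J : ProdPoset n) (m : ℕ) :
    (J.set.filter (· ≤ m + 1)).card =
      (J.set.filter (· ≤ m)).card + if m + 1 ∈ J.set then 1 else 0 := by
  split_ifs with h
  · rw [← Finset.card_insert_of_notMem (a := m + 1) (by simp)]
    congr 1
    ext x
    simp only [Finset.mem_filter, Finset.mem_insert]
    by_cases hx : x = m + 1
    · simp [hx, h]
    · have : x ≤ m + 1 ↔ x ≤ m := by omega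
      simp [hx, this]
  · rw [add_zero]
    congr 1
    ext x
    simp only [Finset.mem_filter]
    by_cases hx : x = m + 1
    · simp [hx, h]
    · have : x ≤ m + 1 ↔ x ≤ m := by omega
      simp [this]

theorem card_filter_le (J : ProdPoset n) (m : ℕ) : (J.set.filter (· ≤ m)).card ≤ m := by
  have : J.set.filter (· ≤ m) ⊆ Finset.Icc 1 m := fun x hx => by
    obtain ⟨h1, h2⟩ := Finset.mem_filter.1 hx
    exact Finset.mem_Icc.2 ⟨one_le_of_mem h1, h2⟩
  simpa using Finset.card_le_card this

theorem initDiag_of_lt {m k : ℕ} (h : m < k) : initDiag n R m k = 0 := by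
  refine entry_ext fun K J => ?_
  have hK := card_filter_le K m
  have hk : ¬k ≤ (K.set.filter (· ≤ m)).card := by omega
  rw [initDiag, entry_incDiag, if_neg hk, ite_self, entry_zero]

/-- The recursion of the elements `y_k^m` holds for the diagonal elements `initDiag m k`. -/
theorem initDiag_succ {m : ℕ} (hm : m + 1 ≤ n) (k : ℕ) :
    initDiag n R (m + 1) (k + 1) = initDiag n R m (k + 1) -
      pAt (incGen n R) (m + 1) * initDiag n R m (k + 1) +
      initDiag n R m k * pAt (incGen n R) (m + 1) := by
  classical
  have hp : pAt (incGen n R) (m + 1) = catalanRep n R (gen ⟨m + 1, by omega, hm⟩) :=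
    dif_pos ⟨by omega, hm⟩
  refine entry_ext fun K J => ?_
  rw [hp, entry_add, entry_sub, initDiag, initDiag, initDiag, entry_mul_incDiag,
    entry_incDiag_mul, entry_incDiag, entry_incDiag, entry_catalanRep, card_filter_le_succ]
  by_cases hc : (gen (⟨m + 1, by omega, hm⟩ : QVertex n)).Carries J K
  · rw [if_pos hc]
    rcases gen_carries hc with ⟨rfl, ht⟩ | ⟨hne, ht, hcard⟩
    · have ht' : m + 1 ∈ K.set := ht
      simp [ht']
    · simp only [Nat.add_sub_cancel] at hcard
      rw [if_neg hne, if_neg hne, ← hcard]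
      simp
  · rw [if_neg hc]
    by_cases hKJ : K = J
    · subst hKJ
      have : m + 1 ∉ K.set := fun h => hc (gen_carries_self h)
      simp [this]
    · simp [hKJ]

/-- The element `y_k^m` projects onto the subsets with at least `k` elements in `{1, …, m}`. -/
theorem yElt_incGen {m : ℕ} (hm : m ≤ n) {k : ℕ} (hk : 1 ≤ k) :
    yElt (incGen n R) m k = initDiag n R m k := by
  induction m generalizing k with
  | zero =>
    exact (initDiag_of_lt hk).symm
  | succ m ih =>
    obtain ⟨k, rfl⟩ := Nat.exists_eq_add_of_le' hk
    simp only [yElt]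
    split_ifs with h1 h2
    · exact (initDiag_of_lt h1).symm
    · obtain rfl : k = 0 := by omega
      rw [ih (by omega) le_rfl, initDiag_succ hm, initDiag_zero, one_mul]
    · rw [ih (by omega) hk, ih (by omega) (by omega), initDiag_succ hm, Nat.add_sub_cancel]

theorem initDiag_self (k : ℕ) :
    initDiag n R n k = incDiag fun J => if k ≤ J.set.card then 1 else 0 := by
  refine congrArg incDiag (funext fun J => ?_)
  rw [Finset.filter_true_of_mem fun x hx => le_of_mem hx]

theorem zElt_incGen (k : ℕ) : zElt (incGen n R) k = cardDiag n R k := by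
  have key : ∀ k, cardDiag n R k = initDiag n R n k - initDiag n R n (k + 1) := by
    intro k
    refine entry_ext fun K J => ?_
    rw [initDiag_self, initDiag_self, cardDiag, entry_sub, entry_incDiag, entry_incDiag,
      entry_incDiag]
    split_ifs <;> first | omega | simp
  rw [key, zElt]
  split_ifs with h
  · subst h
    rw [initDiag_zero, yElt_incGen le_rfl le_rfl]
  · rw [yElt_incGen le_rfl (by omega), yElt_incGen le_rfl (by omega)]

theorem sum_fElt_incGen : ∑ J : ProdPoset n, fElt (incGen n R) J = 1 := by
  classical
  refine entry_ext fun K I => ?_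
  have hf : ∀ J : ProdPoset n, entry (fElt (incGen n R) J) K I =
      if J.set.card = I.set.card then
        (if J.set = ∅ then entry (1 : IncAlgebra R n) K I
          else entry (gElt (incGen n R) n J.set) K I) else 0 := by
    intro J
    rw [fElt]
    split_ifs with h1 h2 h3
    · rw [zElt_incGen, cardDiag, entry_incDiag, entry_one]
      by_cases h4 : K = I
      · rw [if_pos h4, if_pos h4, if_pos (by rw [h4, ← h2, h1, Finset.card_empty])]
      · rw [if_neg h4, if_neg h4]
    · rw [zElt_incGen, cardDiag, entry_incDiag]
      split_ifs with h4 h5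
      · exact absurd (by rw [← h4, h5, h1, Finset.card_empty]) h2
      · rfl
      · rfl
    · rw [zElt_incGen, cardDiag, entry_mul_incDiag, if_pos h3.symm, mul_one]
    · rw [zElt_incGen, cardDiag, entry_mul_incDiag, if_neg (Ne.symm h3), mul_zero]
  rw [entry_sum, Finset.sum_congr rfl fun J _ => hf J, ← Finset.sum_filter]
  have hbij : ∀ F : Finset ℕ → R,
      ∑ J ∈ Finset.univ.filter (fun J : ProdPoset n => J.set.card = I.set.card), F J.set =
        ∑ J ∈ (Finset.Icc 1 n).powersetCard I.set.card, F J := by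
    intro F
    refine Finset.sum_bij (fun J _ => J.set) (fun J hJ => ?_) (fun _ _ _ _ h => ProdPoset.ext h)
      (fun J hJ => ?_) fun _ _ => rfl
    · exact Finset.mem_powersetCard.2 ⟨J.subset, (Finset.mem_filter.1 hJ).2⟩
    · obtain ⟨h1, h2⟩ := Finset.mem_powersetCard.1 hJ
      exact ⟨⟨J, h1⟩, Finset.mem_filter.2 ⟨Finset.mem_univ _, h2⟩, rfl⟩
  rw [hbij fun J => if J = ∅ then entry (1 : IncAlgebra R n) K I
    else entry (gElt (incGen n R) n J) K I]
  rcases Nat.eq_zero_or_pos I.set.card with h0 | h0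
  · rw [h0, Finset.powersetCard_zero, Finset.sum_singleton, if_pos rfl]
  · have : ∀ J ∈ (Finset.Icc 1 n).powersetCard I.set.card,
        (if J = ∅ then entry (1 : IncAlgebra R n) K I
          else entry (gElt (incGen n R) n J) K I) = entry (gElt (incGen n R) n J) K I := by
      intro J hJ
      refine if_neg fun e => ?_
      have := (Finset.mem_powersetCard.1 hJ).2
      rw [e, Finset.card_empty] at this
      omega
    rw [Finset.sum_congr rfl this, ← entry_sum, sum_gElt _ _ _ h0, yElt_incGen le_rfl h0,
      initDiag_self, entry_incDiag, entry_one]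
    split_ifs with h1 h2
    · rfl
    · exact absurd (h1 ▸ le_rfl) h2
    · rfl

/-! ### The base change -/

variable (n R) in
/-- The matrix `E`: its row at `J` is the row of the monomial `p_(J,J)` at `J`. -/
def baseE : IncAlgebra R n where
  toFun a b := pMonomial (incGen n R) (OrderDual.ofDual a) (OrderDual.ofDual a) a b
  eq_zero_of_not_le' _ _ hab := IncidenceAlgebra.apply_eq_zero_of_not_le hab _

variable (n R) in
/-- The matrix `U`: its column at `J` is the column at `J` of a left cofactor of `p_(J,J)` in
`f_J`. -/
def baseU : IncAlgebra R n where
  toFun a b := (exists_fElt_eq_mul (incGen n R) (OrderDual.ofDual b)).choose a b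
  eq_zero_of_not_le' _ _ hab := IncidenceAlgebra.apply_eq_zero_of_not_le hab _

/-- On subsets of the right size, `p_(K,J)` has rank one: its only non-zero row is that of `K`,
and it does not depend on `K`. -/
theorem pMonomial_mul_cardDiag {K J : ProdPoset n} (h : J ≤ K) :
    pMonomial (incGen n R) K J * cardDiag n R J.set.card = incX R K J h * baseE n R := by
  classical
  refine entry_ext fun L I => ?_
  have hE : entry (baseE n R) J I = entry (pMonomial (incGen n R) J J) J I := rfl
  rw [cardDiag, entry_mul_incDiag, entry_incX_mul, hE, pMonomial_incGen, pMonomial_incGen,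
    entry_catalanRep, entry_catalanRep]
  have := ofPair_carries_iff (I := I) (L := L) h
  simp only [mul_ite, mul_one, mul_zero, ← ite_and]
  exact if_congr (and_comm.trans this) rfl rfl

theorem incX_mul_incX {K J I : ProdPoset n} (h : J ≤ K) (h' : I ≤ J) :
    incX R K J h * incX R J I h' = incX R K I (h'.trans h) := by
  refine entry_ext fun L M => ?_
  rw [entry_incX_mul, entry_incX, entry_incX, ← ite_and]
  exact if_congr (by simp) rfl rfl

theorem fElt_incGen (J : ProdPoset n) :
    fElt (incGen n R) J = baseU n R * incX R J J le_rfl * baseE n R := by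
  have hs := (exists_fElt_eq_mul (incGen n R) J).choose_spec
  have hU : ∀ L, entry (baseU n R) L J =
    entry (exists_fElt_eq_mul (incGen n R) J).choose L J := fun _ => rfl
  generalize (exists_fElt_eq_mul (incGen n R) J).choose = c at hs hU
  rw [hs, zElt_incGen, mul_assoc, pMonomial_mul_cardDiag le_rfl, ← mul_assoc]
  congr 1
  refine entry_ext fun L I => ?_
  rw [entry_mul_incX, entry_mul_incX, hU]

theorem sum_incX_self : ∑ J : ProdPoset n, incX R J J le_rfl = 1 := by
  classical
  refine entry_ext fun K I => ?_
  rw [entry_sum, Finset.sum_eq_single K, entry_incX, entry_one]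
  · exact if_congr (by simp [eq_comm]) rfl rfl
  · intro J _ hJ
    rw [entry_incX, if_neg fun e => hJ e.1.symm]
  · simp

theorem baseU_mul_baseE : baseU n R * baseE n R = 1 := by
  rw [← sum_fElt_incGen, Finset.sum_congr rfl fun J _ => fElt_incGen J, ← Finset.sum_mul,
    ← Finset.mul_sum, sum_incX_self, mul_one]

theorem baseE_mul_baseU : baseE n R * baseU n R = 1 := inc_mul_eq_one_comm baseU_mul_baseE

theorem incX_mul_baseE_mul_incX {K J : ProdPoset n} (h : J ≤ K) :
    incX R K K le_rfl * baseE n R * incX R K J h = incX R K J h := by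
  classical
  refine entry_ext fun L I => ?_
  have hE : entry (baseE n R) K K = entry (pMonomial (incGen n R) K K) K K := rfl
  rw [entry_mul_incX, entry_incX_mul, hE, pMonomial_incGen, entry_catalanRep,
    if_pos (ofPair_carries_self K), entry_incX, ← ite_and]
  exact if_congr and_comm rfl rfl

/-- The images of the elements `f_K p_(K,J) f_J` are the matrix units in a different basis. -/
theorem fElt_mul_pMonomial_mul_fElt_incGen {K J : ProdPoset n} (h : J ≤ K) :
    fElt (incGen n R) K * pMonomial (incGen n R) K J * fElt (incGen n R) J =
      baseU n R * incX R K J h * baseE n R := by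
  have hz : cardDiag n R J.set.card * (baseU n R * incX R J J le_rfl) =
      baseU n R * incX R J J le_rfl := by
    rw [cardDiag_comm]
    refine entry_ext fun L I => ?_
    rw [cardDiag, entry_mul_incDiag, entry_mul_incX]
    split_ifs with h1 h2 h2
    · rw [mul_one]
    · exact absurd (h1 ▸ rfl) h2
    · rw [zero_mul]
    · rw [zero_mul]
  have h1 : pMonomial (incGen n R) K J * fElt (incGen n R) J = incX R K J h * baseE n R := by
    rw [fElt_incGen, ← hz, ← mul_assoc, ← mul_assoc, pMonomial_mul_cardDiag h, mul_assoc,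
      mul_assoc, mul_assoc, ← mul_assoc (baseE n R), baseE_mul_baseU, one_mul, ← mul_assoc,
      incX_mul_incX]
  rw [mul_assoc, h1, fElt_incGen, mul_assoc, mul_assoc, ← mul_assoc (baseE n R),
    ← mul_assoc (incX R K K le_rfl), ← mul_assoc (incX R K K le_rfl),
    incX_mul_baseE_mul_incX, ← mul_assoc]

/-- Conjugation by the base change. -/
def baseConj : IncAlgebra R n ≃ₐ[R] IncAlgebra R n where
  toFun x := baseU n R * x * baseE n R
  invFun x := baseE n R * x * baseU n R
  left_inv x := by
    simp only [mul_assoc, baseE_mul_baseU, mul_one]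
    rw [← mul_assoc, baseE_mul_baseU, one_mul]
  right_inv x := by
    simp only [mul_assoc, baseU_mul_baseE, mul_one]
    rw [← mul_assoc, baseU_mul_baseE, one_mul]
  map_mul' x y := by
    have : baseE n R * (baseU n R * (y * baseE n R)) = y * baseE n R := by
      rw [← mul_assoc, baseE_mul_baseU, one_mul]
    simp only [mul_assoc, this]
  map_add' x y := by rw [mul_add, add_mul]
  commutes' r := by
    rw [← Algebra.commutes, mul_assoc, baseU_mul_baseE, mul_one]

theorem baseConj_incX {K J : ProdPoset n} (h : J ≤ K) :
    baseConj (incX R K J h) =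
      fElt (incGen n R) K * pMonomial (incGen n R) K J * fElt (incGen n R) J :=
  (fElt_mul_pMonomial_mul_fElt_incGen h).symm

/-- An algebra that is faithfully represented in the incidence algebra, in such a way that the
elements `p_t` act as the generators of the Catalan monoid, is isomorphic to it. -/
theorem exists_algEquiv_of_injective {A : Type*} [Ring A] [Algebra R A] (p : QVertex n → A)
    (T : A →ₐ[R] IncAlgebra R n) (hT : Function.Injective T)
    (hp : ∀ t, T (p t) = incGen n R t) :
    ∃ Φ : IncAlgebra R n ≃ₐ[R] A, ∀ (K J : ProdPoset n) (h : J ≤ K),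
      Φ (incX R K J h) = fElt p K * pMonomial p K J * fElt p J := by
  have hmap : ∀ (K J : ProdPoset n) (h : J ≤ K),
      T (fElt p K * pMonomial p K J * fElt p J) = baseConj (incX R K J h) := by
    intro K J h
    have hp' : (fun t => (T : A →+* IncAlgebra R n) (p t)) = incGen n R := funext hp
    change (T : A →+* IncAlgebra R n) _ = _
    rw [baseConj_incX, map_mul, map_mul, map_fElt, map_pMonomial, map_fElt, hp']
  have hsurj : Function.Surjective T := by
    intro x
    obtain ⟨x, rfl⟩ := baseConj.surjective x
    have hx : x ∈ Submodule.span R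
        {f : IncAlgebra R n | ∃ (K J : ProdPoset n) (h : J ≤ K), f = incX R K J h} := by
      rw [span_incX]
      trivial
    induction hx using Submodule.span_induction with
    | mem x hx =>
      obtain ⟨K, J, h, rfl⟩ := hx
      exact ⟨_, hmap K J h⟩
    | zero => exact ⟨0, by rw [map_zero, map_zero]⟩
    | add x y _ _ hx hy =>
      obtain ⟨a, ha⟩ := hx
      obtain ⟨b, hb⟩ := hy
      exact ⟨a + b, by rw [map_add, map_add, ha, hb]⟩
    | smul r x _ hx =>
      obtain ⟨a, ha⟩ := hx
      exact ⟨r • a, by rw [map_smul, map_smul, ha]⟩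
  let e := AlgEquiv.ofBijective T ⟨hT, hsurj⟩
  refine ⟨baseConj.trans e.symm, fun K J h => ?_⟩
  rw [AlgEquiv.trans_apply, ← hmap]
  exact e.symm_apply_apply _

end Images

/-! ### Quotient functors -/

section QuotientFunctors

variable {k : Type u} [Field k] {A : Type u} [Ring A] [Algebra k A]

/-- A subfunctor of the identity functor of `mod A`: a submodule of every module, compatible with
all homomorphisms. -/
structure SubIdentity (k : Type u) [Field k] (A : Type u) [Ring A] [Algebra k A] where
  /-- the submodule of a module -/
  sub : ∀ M : FinDimMod k A, Submodule A M.obj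
  le_comap : ∀ {M N : FinDimMod k A} (φ : M ⟶ N), sub M ≤ (sub N).comap φ.hom.hom

namespace SubIdentity

/-- The quotient functor `M ↦ M / K(M)` of a subfunctor `K` of the identity. -/
def quot (K : SubIdentity k A) : FinDimMod k A ⥤ FinDimMod k A where
  obj M := ⟨ModuleCat.of A (M.obj ⧸ K.sub M), isFinDim_quotient k M.obj M.property _⟩
  map {M N} φ := ObjectProperty.homMk (ModuleCat.ofHom
    (Submodule.mapQ (K.sub M) (K.sub N) φ.hom.hom (K.le_comap φ)))
  map_id _ := ObjectProperty.hom_ext _ (ModuleCat.hom_ext (Submodule.mapQ_id _))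
  map_comp φ ψ := ObjectProperty.hom_ext _ (ModuleCat.hom_ext
    (Submodule.mapQ_comp _ _ _ φ.hom.hom ψ.hom.hom (K.le_comap _) (K.le_comap _)))

/-- The quotient map `M → M / K(M)`. -/
def proj (K : SubIdentity k A) (M : FinDimMod k A) : M.obj →ₗ[A] (K.quot.obj M).obj :=
  (K.sub M).mkQ

theorem proj_surjective (K : SubIdentity k A) (M : FinDimMod k A) :
    Function.Surjective (K.proj M) :=
  Submodule.mkQ_surjective _

theorem proj_eq_zero (K : SubIdentity k A) {M : FinDimMod k A} {m : M.obj} :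
    K.proj M m = 0 ↔ m ∈ K.sub M :=
  Submodule.Quotient.mk_eq_zero _

/-- The projection functor `p_U` is the quotient functor of the trace of `U`. -/
theorem projFunctor_eq_quot (K : SubIdentity k A) (U : FinDimMod k A)
    (h : ∀ M : FinDimMod k A, genSubmodule A U.obj M.obj = K.sub M) :
    projFunctor k A U = K.quot := by
  obtain ⟨sub, le_comap⟩ := K
  obtain rfl : (fun M : FinDimMod k A => genSubmodule A U.obj M.obj) = sub := funext h
  rfl

/-- The quotient by the zero submodule is the identity functor. -/
theorem mk_quot_eq_one (K : SubIdentity k A) (h : ∀ M, K.sub M = ⊥) :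
    EndoClass.mk K.quot = 1 := by
  refine Quotient.sound ⟨NatIso.ofComponents (fun M => ObjectProperty.isoMk _
    (LinearEquiv.toModuleIso (Submodule.quotEquivOfEqBot (K.sub M) (h M)))) ?_⟩
  intro M N φ
  refine ObjectProperty.hom_ext _ (ModuleCat.hom_ext (LinearMap.ext fun x => ?_))
  obtain ⟨m, rfl⟩ := K.proj_surjective M x
  rfl

/-- The composition of two quotient functors is the quotient functor of the iterated
preimage. -/
theorem mk_quot_mul (K K' L : SubIdentity k A)
    (h : ∀ (M : FinDimMod k A) (m : M.obj), m ∈ L.sub M ↔ K.proj M m ∈ K'.sub (K.quot.obj M)) :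
    EndoClass.mk K'.quot * EndoClass.mk K.quot = EndoClass.mk L.quot := by
  have hker : ∀ M : FinDimMod k A,
      L.sub M = LinearMap.ker ((K'.proj (K.quot.obj M)).comp (K.proj M)) := fun M => by
    ext m
    rw [h, LinearMap.mem_ker, LinearMap.comp_apply, proj_eq_zero]
  symm
  refine Quotient.sound ⟨NatIso.ofComponents (fun M => ObjectProperty.isoMk _
    (LinearEquiv.toModuleIso ((Submodule.quotEquivOfEq _ _ (hker M)).trans
      (LinearMap.quotKerEquivOfSurjective ((K'.proj (K.quot.obj M)).comp (K.proj M))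
        ((K'.proj_surjective _).comp (K.proj_surjective M)))))) ?_⟩
  intro M N φ
  refine ObjectProperty.hom_ext _ (ModuleCat.hom_ext (LinearMap.ext fun x => ?_))
  obtain ⟨m, rfl⟩ := L.proj_surjective M x
  rfl

end SubIdentity

theorem genSubmodule_congr {U V : Type u} [AddCommGroup U] [Module A U] [AddCommGroup V]
    [Module A V] (e : U ≃ₗ[A] V) (M : Type u) [AddCommGroup M] [Module A M] :
    genSubmodule A U M = genSubmodule A V M := by
  have key : ∀ {U V : Type u} [AddCommGroup U] [Module A U] [AddCommGroup V] [Module A V]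
      (_ : U ≃ₗ[A] V) (X : Submodule A M), IsGeneratedBy A U X → IsGeneratedBy A V X := by
    rintro U V _ _ _ _ e X ⟨d, f, hf⟩
    exact ⟨d, f.comp (LinearEquiv.piCongrRight fun _ => e.symm).toLinearMap,
      hf.comp (LinearEquiv.surjective _)⟩
  unfold genSubmodule
  congr 1
  ext X
  exact ⟨key e X, key e.symm X⟩

end QuotientFunctors

/-! ### Paths of the linear quiver -/

section Paths

open Quiver PathAlgebra

variable {n : ℕ}

theorem QVertex.le_of_path {i j : QVertex n} (p : Path i j) : i.val ≤ j.val := by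
  induction p with
  | nil => exact le_rfl
  | cons _ e ih =>
    have := e.down
    omega

theorem QVertex.path_eq {i j : QVertex n} (p q : Path i j) : p = q := by
  induction p with
  | nil =>
    cases q with
    | nil => rfl
    | cons q e =>
      have := e.down
      have := le_of_path q
      omega
  | cons p e ih =>
    cases q with
    | nil =>
      have := e.down
      have := le_of_path p
      omega
    | cons q f =>
      have h1 := e.down
      have h2 := f.down
      obtain rfl := QVertex.ext (Nat.succ_injective (h1.symm.trans h2))
      rw [ih q, show e = f from PLift.down_injective (Subsingleton.elim _ _)]

theorem QVertex.nonempty_path {i j : QVertex n} (h : i.val ≤ j.val) : Nonempty (Path i j) := by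
  obtain ⟨d, hd⟩ := Nat.exists_eq_add_of_le h
  induction d generalizing j with
  | zero =>
    obtain rfl : i = j := QVertex.ext hd.symm
    exact ⟨.nil⟩
  | succ d ih =>
    have hj := j.le_n
    have hi := i.one_le
    obtain ⟨p⟩ := @ih ⟨i.val + d, by omega, by omega⟩ (Nat.le_add_right _ _) rfl
    exact ⟨p.cons ⟨hd⟩⟩

instance : Finite (Σ a b : QVertex n, Path a b) :=
  Finite.of_injective (fun x => ((x.1, x.2.1) : QVertex n × QVertex n)) (by
    rintro ⟨a, b, p⟩ ⟨c, d, q⟩ h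
    obtain ⟨rfl, rfl⟩ := Prod.mk.inj h
    rw [QVertex.path_eq p q])

variable (k : Type u) [Field k]

theorem isFinDim_self (n : ℕ) : isFinDim k (PathAlgebra k (QVertex n))
    (ModuleCat.of _ (PathAlgebra k (QVertex n))) := by
  have : Module.Finite k (PathAlgebra k (QVertex n)) :=
    inferInstanceAs (Module.Finite k ((Σ a b : QVertex n, Path a b) →₀ k))
  let N := (ModuleCat.restrictScalars (algebraMap k (PathAlgebra k (QVertex n)))).obj
    (ModuleCat.of _ (PathAlgebra k (QVertex n)))
  let g : PathAlgebra k (QVertex n) →ₗ[k] N :=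
    { toFun := fun x => x
      map_add' := fun _ _ => rfl
      map_smul' := fun c x => Algebra.smul_def c x }
  exact Module.Finite.of_surjective g fun x => ⟨x, rfl⟩

/-- The regular module. -/
def regularModule (n : ℕ) : FinDimMod k (PathAlgebra k (QVertex n)) :=
  ⟨ModuleCat.of _ (PathAlgebra k (QVertex n)), isFinDim_self k n⟩

end Paths

/-! ### The functors attached to the elements of the Catalan monoid -/

section CatalanFunctors

open Quiver PathAlgebra

variable {k : Type u} [Field k] {n : ℕ}

/-- The elements of a module killed by all paths `i → j` with `i ≤ θ j`.  As a representation of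
the quiver, its component at `i` is the common kernel of the maps from `i` to all such `j`. -/
def pathKernel (θ : CatalanMonoid n) (M : Type u) [AddCommGroup M]
    [Module (PathAlgebra k (QVertex n)) M] : Submodule (PathAlgebra k (QVertex n)) M where
  carrier := {m | ∀ (i j : QVertex n) (p : Path i j), i.val ≤ θ j.val →
    (single p 1 : PathAlgebra k (QVertex n)) • m = 0}
  add_mem' := fun ha hb i j p h => by rw [smul_add, ha i j p h, hb i j p h, add_zero]
  zero_mem' := fun _ _ _ _ => smul_zero _
  smul_mem' := fun a m hm i j p h => by
    induction a using PathAlgebra.induction with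
    | zero => rw [zero_smul, smul_zero]
    | add f g hf hg => rw [add_smul, smul_add, hf, hg, add_zero]
    | @single a b q r =>
      rw [smul_smul]
      by_cases hbi : b = i
      · subst hbi
        have hle := QVertex.le_of_path q
        have hs : (single (q.comp p) (1 * r) : PathAlgebra k (QVertex n)) =
            single (Path.nil : Path j j) r * single (q.comp p) 1 := by
          rw [single_mul_single, mul_one, one_mul, Path.comp_nil]
        rw [single_mul_single, hs, mul_smul, hm a j _ (hle.trans h), smul_zero]
      · rw [single_mul_single_of_ne _ _ _ _ hbi, zero_smul]

/-- The subfunctor `pathKernel θ` of the identity. -/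
def pathSub (k : Type u) [Field k] (θ : CatalanMonoid n) :
    SubIdentity k (PathAlgebra k (QVertex n)) where
  sub M := pathKernel θ M.obj
  le_comap φ m hm i j p h := by
    rw [← map_smul, hm i j p h, map_zero]

variable (k n) in
/-- The classes of the quotient functors of the `pathKernel θ` multiply like the `θ`. -/
def catalanFunctor :
    CatalanMonoid n →* EndoClass (FinDimMod k (PathAlgebra k (QVertex n))) where
  toFun θ := EndoClass.mk (pathSub k θ).quot
  map_one' := by
    refine SubIdentity.mk_quot_eq_one _ fun M => ?_
    rw [eq_bot_iff]
    intro m hm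
    rw [Submodule.mem_bot, ← one_smul (PathAlgebra k (QVertex n)) m, one_def, Finset.sum_smul]
    exact Finset.sum_eq_zero fun i _ => hm i i Path.nil le_rfl
  map_mul' θ η := by
    symm
    refine SubIdentity.mk_quot_mul _ _ _ fun M m => ?_
    have h2 : (pathSub k η).proj M m ∈ (pathSub k θ).sub ((pathSub k η).quot.obj M) ↔
        ∀ (i j : QVertex n) (p : Path i j), i.val ≤ θ j.val →
          ∀ (i' j' : QVertex n) (p' : Path i' j'), i'.val ≤ η j'.val →
          (single p' 1 * single p 1 : PathAlgebra k (QVertex n)) • m = 0 := by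
      refine forall_congr' fun i => forall_congr' fun j => forall_congr' fun p =>
        forall_congr' fun h => ?_
      rw [← map_smul, SubIdentity.proj_eq_zero]
      refine forall_congr' fun i' => forall_congr' fun j' => forall_congr' fun p' =>
        forall_congr' fun h' => ?_
      rw [smul_smul]
    rw [h2]
    constructor
    · intro hm i j p h i' j' p' h'
      by_cases hj : j = i'
      · subst hj
        rw [single_mul_single, mul_one]
        exact hm i j' (p.comp p') (h.trans (θ.mono h'))
      · rw [single_mul_single_of_ne _ _ _ _ hj, zero_smul]
    · intro hm i j p h
      -- a path `i → j` with `i ≤ θ (η j)` factors over the vertex `η j`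
      have h' : i.val ≤ θ (η j.val) := h
      have hi := i.one_le
      have h1 := θ.apply_le (η j.val)
      have h3 := η.apply_le j.val
      have hj := j.le_n
      let l : QVertex n := ⟨η j.val, by omega, by omega⟩
      obtain ⟨q⟩ := QVertex.nonempty_path (i := i) (j := l) (h'.trans h1)
      obtain ⟨q'⟩ := QVertex.nonempty_path (i := l) (j := j) h3
      have := hm i l q h' l j q' le_rfl
      rwa [single_mul_single, mul_one, QVertex.path_eq (q.comp q') p] at this

theorem vertexHom_apply (t : QVertex n) (a : PathAlgebra k (QVertex n)) :
    vertexHom k t a = vertexCoeff k t a := rfl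

/-- On `pathKernel (gen t)` the path algebra acts through the coefficient of the trivial path
at `t`. -/
theorem smul_eq_vertexCoeff_smul {t : QVertex n} {M : Type u} [AddCommGroup M]
    [Module (PathAlgebra k (QVertex n)) M] {m : M}
    (hm : m ∈ pathKernel (k := k) (CatalanMonoid.gen t) M) (a : PathAlgebra k (QVertex n)) :
    a • m = algebraMap k (PathAlgebra k (QVertex n)) (vertexHom k t a) • m := by
  have hkill : ∀ (i j : QVertex n) (p : Path i j), (i ≠ t ∨ p.length ≠ 0) →
      (single p 1 : PathAlgebra k (QVertex n)) • m = 0 := by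
    intro i j p h
    refine hm i j p ?_
    have hle := QVertex.le_of_path p
    rw [CatalanMonoid.gen_apply]
    split_ifs with hj
    · have : i.val ≠ j.val := by
        intro hij
        obtain rfl := QVertex.ext hij
        rw [QVertex.path_eq p Path.nil] at h
        exact h.elim (fun h => h (QVertex.ext hj)) fun h => h rfl
      omega
    · exact hle
  have hsingle : ∀ {i j : QVertex n} (p : Path i j) (r : k),
      (single p r : PathAlgebra k (QVertex n)) = algebraMap k _ r * single p 1 := by
    intro i j p r
    rw [← Algebra.smul_def]
    exact (Finsupp.smul_single_one _ _).symm
  have hone : m = (single (Path.nil : Path t t) 1 : PathAlgebra k (QVertex n)) • m := by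
    conv_lhs => rw [← one_smul (PathAlgebra k (QVertex n)) m, one_def, Finset.sum_smul]
    refine Finset.sum_eq_single t (fun i _ hi => hkill i i _ (Or.inl hi)) (by simp)
  induction a using PathAlgebra.induction with
  | zero => rw [map_zero, map_zero, zero_smul]
  | add f g hf hg => rw [map_add, map_add, add_smul, add_smul, hf, hg]
  | @single i j p r =>
    by_cases h : i ≠ t ∨ p.length ≠ 0
    · have h0 : vertexHom k t (single p r) = 0 := by
        rw [vertexHom_apply]
        by_cases hp : p.length = 0
        · obtain rfl := Path.eq_of_length_zero p hp
          obtain rfl := Path.eq_nil_of_length_zero p hp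
          exact vertexCoeff_nil_of_ne (h.resolve_right (not_not.2 hp)) r
        · exact vertexCoeff_of_length p hp t r
      rw [hsingle, mul_smul, hkill i j p h, smul_zero, ← hsingle, h0, map_zero, zero_smul]
    · obtain ⟨rfl, hp⟩ := not_or.1 h |>.imp not_not.1 not_not.1
      obtain rfl := Path.eq_of_length_zero p hp
      obtain rfl := Path.eq_nil_of_length_zero p hp
      have h1 : vertexHom k i (single Path.nil r) = r := vertexCoeff_nil i r
      rw [h1, hsingle, mul_smul, ← hone]

/-- The underlying space of `S_t` is `k`. -/
def simpleAtVal (k : Type u) [Field k] (t : QVertex n) : (simpleAt k t).obj ≃+ k :=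
  AddEquiv.refl k

theorem simpleAtVal_smul (t : QVertex n) (a : PathAlgebra k (QVertex n))
    (c : (simpleAt k t).obj) :
    simpleAtVal k t (a • c) = vertexHom k t a * simpleAtVal k t c := rfl

/-- The homomorphism from `S_t` to a module with a given value in `pathKernel (gen t)`. -/
def simpleAtHom {t : QVertex n} {M : Type u} [AddCommGroup M]
    [Module (PathAlgebra k (QVertex n)) M] {m : M}
    (hm : m ∈ pathKernel (k := k) (CatalanMonoid.gen t) M) :
    (simpleAt k t).obj →ₗ[PathAlgebra k (QVertex n)] M where
  toFun c := algebraMap k (PathAlgebra k (QVertex n)) (simpleAtVal k t c) • m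
  map_add' c d := by rw [map_add, map_add, add_smul]
  map_smul' a c := by
    rw [simpleAtVal_smul, map_mul, mul_smul, RingHom.id_apply,
      smul_eq_vertexCoeff_smul (Submodule.smul_mem _ _ hm) a]

theorem simpleAtHom_one {t : QVertex n} {M : Type u} [AddCommGroup M]
    [Module (PathAlgebra k (QVertex n)) M] {m : M}
    (hm : m ∈ pathKernel (k := k) (CatalanMonoid.gen t) M) :
    simpleAtHom hm ((simpleAtVal k t).symm 1) = m := by
  change algebraMap k (PathAlgebra k (QVertex n)) (simpleAtVal k t _) • m = m
  rw [AddEquiv.apply_symm_apply, map_one, one_smul]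

theorem genSubmodule_simpleAt (t : QVertex n) (M : Type u) [AddCommGroup M]
    [Module (PathAlgebra k (QVertex n)) M] :
    genSubmodule (PathAlgebra k (QVertex n)) (simpleAt k t).obj M =
      pathKernel (CatalanMonoid.gen t) M := by
  refine le_antisymm (sSup_le ?_) fun m hm => ?_
  · rintro X ⟨d, f, hf⟩ m hm i j p h
    obtain ⟨v, hv⟩ := hf ⟨m, hm⟩
    have hm' : m = f v := by rw [hv]
    have h0 : (single p 1 : PathAlgebra k (QVertex n)) • v = 0 := by
      funext l
      apply (simpleAtVal k t).injective
      rw [Pi.smul_apply, simpleAtVal_smul, Pi.zero_apply, map_zero]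
      have : vertexHom k t (single p 1) = 0 := by
        rw [vertexHom_apply]
        by_cases hp : p.length = 0
        · obtain rfl := Path.eq_of_length_zero p hp
          obtain rfl := Path.eq_nil_of_length_zero p hp
          refine vertexCoeff_nil_of_ne (fun e => ?_) 1
          subst e
          rw [CatalanMonoid.gen_apply, if_pos rfl] at h
          have := i.one_le
          omega
        · exact vertexCoeff_of_length p hp t 1
      rw [this, zero_mul]
    rw [hm', ← Submodule.coe_smul, ← map_smul, h0, map_zero, Submodule.coe_zero]
  · have hX : IsGeneratedBy (PathAlgebra k (QVertex n)) (simpleAt k t).obj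
        (LinearMap.range (simpleAtHom hm)) :=
      ⟨1, (simpleAtHom hm).rangeRestrict.comp (LinearMap.proj 0), fun x => by
        obtain ⟨c, hc⟩ := (simpleAtHom hm).surjective_rangeRestrict x
        exact ⟨fun _ => c, hc⟩⟩
    exact le_sSup (a := LinearMap.range (simpleAtHom hm)) hX ⟨_, simpleAtHom_one hm⟩

theorem catalanFunctor_gen (t : QVertex n) :
    catalanFunctor k n (CatalanMonoid.gen t) =
      EndoClass.mk (projFunctor k (PathAlgebra k (QVertex n)) (simpleAt k t)) :=
  congrArg EndoClass.mk (SubIdentity.projFunctor_eq_quot (pathSub k _) _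
    fun M => genSubmodule_simpleAt t M.obj).symm

/-- Every simple module is isomorphic to some `S_t`: a non-zero element at the last vertex `t`
with a non-zero component is killed by all arrows. -/
theorem exists_equiv_simpleAt (S : Type u) [AddCommGroup S]
    [Module (PathAlgebra k (QVertex n)) S] [IsSimpleModule (PathAlgebra k (QVertex n)) S] :
    ∃ t : QVertex n, Nonempty ((simpleAt k t).obj ≃ₗ[PathAlgebra k (QVertex n)] S) := by
  classical
  -- the vertices with a non-zero component
  let P : Finset (QVertex n) := Finset.univ.filter fun t =>
    ∃ x : S, (single (Path.nil : Path t t) 1 : PathAlgebra k (QVertex n)) • x ≠ 0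
  have hP : P.Nonempty := by
    have := IsSimpleModule.nontrivial (PathAlgebra k (QVertex n)) S
    obtain ⟨x, hx⟩ := exists_ne (0 : S)
    by_contra hne
    rw [Finset.not_nonempty_iff_eq_empty, Finset.filter_eq_empty_iff] at hne
    refine hx ?_
    rw [← one_smul (PathAlgebra k (QVertex n)) x, one_def, Finset.sum_smul]
    refine Finset.sum_eq_zero fun t _ => ?_
    by_contra h0
    exact hne (Finset.mem_univ t) ⟨x, h0⟩
  obtain ⟨t, ht, hmax⟩ := P.exists_max_image (fun t => t.val) hP
  obtain ⟨x, hx⟩ := (Finset.mem_filter.1 ht).2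
  have hm : (single (Path.nil : Path t t) 1 : PathAlgebra k (QVertex n)) • x ∈
      pathKernel (k := k) (CatalanMonoid.gen t) S := by
    intro i j p h
    rw [smul_smul]
    by_cases hi : t = i
    · subst hi
      have hle := QVertex.le_of_path p
      have hne : t.val ≠ j.val := by
        intro e
        rw [CatalanMonoid.gen_apply, if_pos e.symm] at h
        have := t.one_le
        omega
      rw [single_mul_single, Path.nil_comp, mul_one]
      by_contra h0
      have hj : j ∈ P := by
        refine Finset.mem_filter.2 ⟨Finset.mem_univ _,
          (single p 1 : PathAlgebra k (QVertex n)) • x, ?_⟩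
        rwa [smul_smul, single_mul_single, Path.comp_nil, mul_one]
      have := hmax j hj
      omega
    · rw [single_mul_single_of_ne _ _ _ _ hi, zero_smul]
  have := isSimpleModule_simpleAt (k := k) t
  refine ⟨t, ⟨LinearEquiv.ofBijective (simpleAtHom hm)
    ((simpleAtHom hm).bijective_or_eq_zero.resolve_right fun h0 => hx ?_)⟩⟩
  rw [← simpleAtHom_one hm, h0, LinearMap.zero_apply]

theorem mk_projFunctor_of_isSimpleModule
    (S : FinDimMod k (PathAlgebra k (QVertex n)))
    (hS : IsSimpleModule (PathAlgebra k (QVertex n)) S.obj) :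
    ∃ t : QVertex n, EndoClass.mk (projFunctor k (PathAlgebra k (QVertex n)) S) =
      catalanFunctor k n (CatalanMonoid.gen t) := by
  obtain ⟨t, ⟨e⟩⟩ := exists_equiv_simpleAt (k := k) (n := n) S.obj
  exact ⟨t, congrArg EndoClass.mk (SubIdentity.projFunctor_eq_quot (pathSub k _) _ fun M =>
    (genSubmodule_congr e.symm M.obj).trans (genSubmodule_simpleAt t M.obj))⟩

/-- The value at the regular module determines `θ n`: the component at `i` of `A / K(A)` vanishes
if and only if `θ n < i`. -/
theorem quot_regularModule_eq_zero_iff (θ : CatalanMonoid n) (i : QVertex n) :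
    (∀ x : ((pathSub k θ).quot.obj (regularModule k n)).obj,
      (single (Path.nil : Path i i) 1 : PathAlgebra k (QVertex n)) • x = 0) ↔ θ n < i.val := by
  constructor
  · intro h
    by_contra hlt
    let l : QVertex n := ⟨n, i.one_le.trans i.le_n, le_rfl⟩
    obtain ⟨p⟩ := QVertex.nonempty_path (i := i) (j := l) i.le_n
    let u : (regularModule k n).obj := (1 : PathAlgebra k (QVertex n))
    have h1 := h ((pathSub k θ).proj (regularModule k n) u)
    rw [← map_smul, SubIdentity.proj_eq_zero] at h1
    have h2 := h1 i l p (not_lt.1 hlt)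
    have h3 : (single p 1 : PathAlgebra k (QVertex n)) = 0 := by
      have h4 : (single p 1 * (single (Path.nil : Path i i) 1 * 1) :
        PathAlgebra k (QVertex n)) = 0 := h2
      rwa [mul_one, single_mul_single, Path.nil_comp, mul_one] at h4
    exact one_ne_zero (Finsupp.single_eq_zero.1 h3)
  · intro h x
    obtain ⟨a, rfl⟩ := (pathSub k θ).proj_surjective (regularModule k n) x
    rw [← map_smul, SubIdentity.proj_eq_zero]
    intro i' j p h'
    rw [smul_smul]
    have hi : i ≠ i' := by
      rintro rfl
      have : θ j.val ≤ θ n := θ.mono j.le_n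
      omega
    rw [single_mul_single_of_ne _ _ _ _ hi, zero_smul]

theorem apply_eq_of_catalanFunctor_eq {θ η : CatalanMonoid n}
    (h : catalanFunctor k n θ = catalanFunctor k n η) : θ n = η n := by
  obtain ⟨e⟩ : Nonempty ((pathSub k θ).quot ≅ (pathSub k η).quot) := Quotient.exact h
  let e' := ((isFinDim k (PathAlgebra k (QVertex n))).ι.mapIso
    (e.app (regularModule k n))).toLinearEquiv
  have key : ∀ i : QVertex n, θ n < i.val ↔ η n < i.val := fun i => by
    rw [← quot_regularModule_eq_zero_iff (k := k), ← quot_regularModule_eq_zero_iff (k := k)]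
    constructor
    · intro H x
      obtain ⟨y, rfl⟩ := e'.surjective x
      exact (e'.map_smul _ y).symm.trans ((congrArg e' (H y)).trans (map_zero e'))
    · intro H x
      obtain ⟨y, rfl⟩ := e'.symm.surjective x
      exact (e'.symm.map_smul _ y).symm.trans ((congrArg e'.symm (H y)).trans (map_zero e'.symm))
  have h1 := θ.apply_le n
  have h2 := η.apply_le n
  by_contra hne
  rcases Nat.lt_or_gt_of_ne hne with hlt | hlt
  · have := (key ⟨η n, by omega, h2⟩).1 hlt
    exact lt_irrefl _ this
  · have := (key ⟨θ n, by omega, h1⟩).2 hlt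
    exact lt_irrefl _ this

/-- Composition with a truncation moves every value of `θ` to `n`, so the functors of distinct
elements of the Catalan monoid are not isomorphic. -/
theorem catalanFunctor_injective : Function.Injective (catalanFunctor k n) := by
  intro θ η h
  ext j
  by_cases hj : j ≤ n
  · have : ∀ ζ : CatalanMonoid n, (ζ * CatalanMonoid.trunc n j) n = ζ j := fun ζ => by
      rw [CatalanMonoid.mul_apply, CatalanMonoid.trunc_apply, if_pos le_rfl, min_eq_left hj]
    rw [← this θ, ← this η]
    exact apply_eq_of_catalanFunctor_eq (by rw [map_mul, map_mul, h])
  · rw [θ.apply_of_lt (by omega), η.apply_of_lt (by omega)]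

theorem projMonoid_le_range :
    projMonoid k (PathAlgebra k (QVertex n)) ≤ MonoidHom.mrange (catalanFunctor k n) := by
  refine Submonoid.closure_le.2 ?_
  rintro _ ⟨S, hS, rfl⟩
  obtain ⟨t, ht⟩ := mk_projFunctor_of_isSimpleModule S hS
  exact ⟨_, ht.symm⟩

variable (k n) in
/-- The Catalan monoid as a monoid of classes of functors. -/
def catalanEquiv : CatalanMonoid n ≃* MonoidHom.mrange (catalanFunctor k n) :=
  MulEquiv.ofBijective (catalanFunctor k n).mrangeRestrict
    ⟨fun _ _ h => catalanFunctor_injective (congrArg Subtype.val h),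
      (catalanFunctor k n).mrangeRestrict_surjective⟩

variable (k n) in
/-- The embedding of the monoid of projection functors into the Catalan monoid. -/
def qMonoidHom : QMonoid k n →* CatalanMonoid n :=
  (catalanEquiv k n).symm.toMonoidHom.comp (Submonoid.inclusion projMonoid_le_range)

theorem catalanFunctor_qMonoidHom (m : QMonoid k n) :
    catalanFunctor k n (qMonoidHom k n m) = m.1 :=
  congrArg Subtype.val
    ((catalanEquiv k n).apply_symm_apply (Submonoid.inclusion projMonoid_le_range m))

theorem qMonoidHom_injective : Function.Injective (qMonoidHom k n) := fun a b h =>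
  Subtype.ext (by rw [← catalanFunctor_qMonoidHom, h, catalanFunctor_qMonoidHom])

theorem qMonoidHom_pVertex (t : QVertex n) :
    qMonoidHom k n (pVertex k t) = CatalanMonoid.gen t :=
  catalanFunctor_injective (k := k) (by
    rw [catalanFunctor_qMonoidHom, catalanFunctor_gen]
    rfl)

end CatalanFunctors

end

theorem mainTheorem1 (n : ℕ) :
    ∃ c : ProdPoset n → ProdPoset n → FreeAlgebra ℤ (QVertex n),
      ∀ (k : Type u) [Field k] (R : Type v) [Field R],
        ∃ Φ : IncAlgebra R n ≃ₐ[R] QAlgebra k R n,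
          (∀ (K J : ProdPoset n) (h : J ≤ K),
            Φ (incX R K J h) = fElt (pGen k R) K * pMonomial (pGen k R) K J * fElt (pGen k R) J) ∧
          (∀ Ψ : IncAlgebra R n →ₗ[R] QAlgebra k R n,
            (∀ (K J : ProdPoset n) (h : J ≤ K), Ψ (incX R K J h) =
              fElt (pGen k R) K * pMonomial (pGen k R) K J * fElt (pGen k R) J) →
            Ψ = Φ.toLinearMap) ∧
          (∀ (K J : ProdPoset n) (h : J ≤ K),
            Φ (incX R K J h) = FreeAlgebra.lift ℤ (pGen k R) (c K J)) := by
  refine ⟨fun K J => fElt (FreeAlgebra.ι ℤ) K * pMonomial (FreeAlgebra.ι ℤ) K J *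
    fElt (FreeAlgebra.ι ℤ) J, fun k _ R _ => ?_⟩
  obtain ⟨Φ, hΦ⟩ := exists_algEquiv_of_injective (pGen k R) (algRep R (qMonoidHom k n))
    (algRep_injective qMonoidHom_injective) fun t => by
      rw [pGen, algRep_of, qMonoidHom_pVertex]
      rfl
  refine ⟨Φ, hΦ, fun Ψ hΨ => ?_, fun K J h => ?_⟩
  · refine LinearMap.ext_on (span_incX (R := R) (n := n)) ?_
    rintro _ ⟨K, J, h, rfl⟩
    exact (hΨ K J h).trans (hΦ K J h).symm
  · let φ : FreeAlgebra ℤ (QVertex n) →+* QAlgebra k R n :=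
      (FreeAlgebra.lift ℤ (pGen k R)).toRingHom
    have hι : (fun t => φ (FreeAlgebra.ι ℤ t)) = pGen k R :=
      funext fun t => FreeAlgebra.lift_ι_apply _ t
    change _ = φ _
    rw [hΦ K J h, map_mul, map_mul, map_fElt, map_pMonomial, map_fElt, hι]
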